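/- Let $\mathcal H$ be a complex Hilbert space of finite dimension $d$, and let $\mathcal D$ be the set of states on $\mathcal H$, i.e. operators $\rho\ge 0$ with $\operatorname{tr}\rho=1$. Write $\log$ for the logarithm to base $2$ and, for $\alpha\in(0,1)\cup(1,\infty)$, let $S_\alpha(\rho)=\frac1{1-\alpha}\log\operatorname{tr}[\rho^\alpha]$ be the $\alpha$-Rényi entropy. For $\sigma\in\mathcal D$ and $\varepsilon\in[0,1]$ let $B_\varepsilon(\sigma)=\{\omega\in\mathcal D:\frac12\|\omega-\sigma\|_1\le\varepsilon\}$, where $\|A\|_1=\operatorname{tr}|A|$. Let $\sigma=\sum_{i=1}^d\mu_i|i\rangle\langle i|$ with $\mu_1\ge\dots\ge\mu_d$ and $(|i\rangle)_i$ an orthonormal basis, and let $\tau=\mathbb 1/d$. * $\rho^*_\varepsilon(\sigma)$ is defined as follows. If $\varepsilon=0$, then $\rho^*_\varepsilon(\sigma)=\sigma$. If $\varepsilon>0$ and $\frac12\|\sigma-\tau\|_1\le\varepsilon$, then $\rho^*_\varepsilon(\sigma)=\tau$. Otherwise $$\rho^*_\varepsilon(\sigma)=\sum_{i\le m}\alpha_2|i\rangle\langle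 i|+\sum_{m<i\le d-n}\mu_i|i\rangle\langle i|+\sum_{i>d-n}\alpha_1|i\rangle\langle i|,$$ where $(\alpha_1,n),(\alpha_2,m)\in[0,1]\times\{1,\dots,d-1\}$ are the unique pairs with $\sum_{i=d-n+1}^d|\alpha_1-\mu_i|=\varepsilon$, $\mu_{d-n+1}<\alpha_1\le\mu_{d-n}$, and $\sum_{i=1}^m|\alpha_2-\mu_i|=\varepsilon$, $\mu_{m+1}\le\alpha_2<\mu_m$. * $\rho_{*,\varepsilon}(\sigma)=\sum_{j=1}^d p_j|j\rangle\langle j|$, where, with $Q_l=\sum_{j=d-l+1}^d\mu_j$ and $\ell$ the largest $l\in\{0,\dots,d-1\}$ such that $Q_l\le\varepsilon$: if $\ell=d-1$, then $p=(1,0,\dots,0)$; otherwise $p_1=\mu_1+\varepsilon$, $p_j=\mu_j$ for $2\le j\le d-\ell-1$, $p_{d-\ell}=\mu_{d-\ell}-(\varepsilon-Q_\ell)$, and $p_j=0$ for $j>d-\ell$. Put $c_\alpha=[\ln(2)(1-\alpha)]^{-1}$, $r_\alpha(\varepsilon)=c_\alpha[\varepsilon^\alpha+(1-\varepsilon)^\alpha-1]$,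 $g_\alpha(x)=c_\alpha(x^{1-\alpha}-1)$ and $\eta_\alpha(x)=c_\alpha(x^\alpha-x)$. **Proposition.** Let $\alpha\in(0,1)\cup(1,\infty)$, $\sigma\in\mathcal D$ and $\varepsilon\in[0,1]$, and let $$L=\max\{S_\alpha(\rho^*_\varepsilon(\sigma))-S_\alpha(\sigma),\ S_\alpha(\sigma)-S_\alpha(\rho_{*,\varepsilon}(\sigma))\}.$$ Then $|S_\alpha(\omega)-S_\alpha(\sigma)|\le L$ for every $\omega\in B_\varepsilon(\sigma)$. Moreover, $$L\le\begin{cases}(2\varepsilon)^\alpha g_\alpha(d)+\eta_\alpha(2\varepsilon)&\text{if }\alpha<1\text{ and }\varepsilon<\alpha^{1/(1-\alpha)},\\ d^{2(\alpha-1)}[g_\alpha(d-1)+r_\alpha(\varepsilon)]&\text{if }\alpha>1\text{ and }\varepsilon<1-\frac1d,\\ \log d&\text{if }\alpha>1\text{ and }\varepsilon\ge1-\frac1d.\end{cases}$$ -/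

import Mathlib

noncomputable section

namespace RenyiBall

variable {H : Type*} [NormedAddCommGroup H] [InnerProductSpace ℂ H] [FiniteDimensional ℂ H]
  [CompleteSpace H]

/-- The trace of an operator. -/
def tr (A : H →L[ℂ] H) : ℂ := LinearMap.trace ℂ H (A : H →ₗ[ℂ] H)

/-- The trace norm `‖A‖₁ = tr |A|`, where `|A| = (A* A)^(1/2)`. -/
def traceNorm (A : H →L[ℂ] H) : ℝ := (tr (CFC.abs A)).re

/-- Quantum states: positive semidefinite operators of trace one. -/
def State (H : Type*) [NormedAddCommGroup H] [InnerProductSpace ℂ H] [FiniteDimensional ℂ H] :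
    Type _ :=
  {ρ : H →L[ℂ] H // ρ.IsPositive ∧ LinearMap.trace ℂ H (ρ : H →ₗ[ℂ] H) = 1}

/-- The `ε`-ball of states around `σ` in trace distance. -/
def ball (ε : ℝ) (σ : State H) : Set (State H) :=
  {ω | (1 / 2) * traceNorm (ω.1 - σ.1) ≤ ε}

/-- The `α`-Rényi entropy `(1 / (1 - α)) log₂ tr (ρ ^ α)`; the power is given by the continuous
functional calculus. -/
def renyi (α : ℝ) (ρ : H →L[ℂ] H) : ℝ := 1 / (1 - α) * Real.logb 2 (tr (ρ ^ α)).re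

/-- The completely mixed state `1 / d`, as an operator. -/
def mixed (H : Type*) [NormedAddCommGroup H] [InnerProductSpace ℂ H] [FiniteDimensional ℂ H] :
    H →L[ℂ] H :=
  ((Module.finrank ℂ H : ℂ)⁻¹) • (1 : H →L[ℂ] H)

/-- The eigenvalues `μ 1 ≥ μ 2 ≥ ⋯ ≥ μ d` of a state in non-increasing order, counted with
multiplicity. The numbering starts at `1`; indices outside `1, …, d` are never used. -/
def mu (σ : State H) (j : ℕ) : ℝ :=
  if h : 1 ≤ j ∧ j ≤ Module.finrank ℂ H then
    σ.2.1.isSymmetric.eigenvalues rfl ⟨j - 1, by omega⟩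
  else 0

/-- The operator `∑_{j = 1}^d p j |j⟩⟨j|`, where `|1⟩, …, |d⟩` is an orthonormal eigenbasis of `σ`
ordered as the eigenvalues `mu σ 1 ≥ ⋯ ≥ mu σ d`. -/
def diagOp (σ : State H) (p : ℕ → ℝ) : H →L[ℂ] H :=
  ∑ i : Fin (Module.finrank ℂ H), ((p (i.1 + 1) : ℝ) : ℂ) •
    InnerProductSpace.rankOne ℂ (σ.2.1.isSymmetric.eigenvectorBasis rfl i)
      (σ.2.1.isSymmetric.eigenvectorBasis rfl i)

/-- `a` is the level to which the `n` smallest eigenvalues of `σ` are raised when a total weight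
`ε` is added to them. -/
def IsLowLevel (σ : State H) (ε a : ℝ) (n : ℕ) : Prop :=
  a ∈ Set.Icc (0 : ℝ) 1 ∧ n ∈ Finset.Icc 1 (Module.finrank ℂ H - 1) ∧
    ∑ i ∈ Finset.Icc (Module.finrank ℂ H - n + 1) (Module.finrank ℂ H), |a - mu σ i| = ε ∧
    mu σ (Module.finrank ℂ H - n + 1) < a ∧ a ≤ mu σ (Module.finrank ℂ H - n)

/-- `a` is the level to which the `m` largest eigenvalues of `σ` are lowered when a total weight
`ε` is removed from them. -/
def IsHighLevel (σ : State H) (ε a : ℝ) (m : ℕ) : Prop :=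
  a ∈ Set.Icc (0 : ℝ) 1 ∧ m ∈ Finset.Icc 1 (Module.finrank ℂ H - 1) ∧
    ∑ i ∈ Finset.Icc 1 m, |a - mu σ i| = ε ∧
    mu σ (m + 1) ≤ a ∧ a < mu σ m

/-- The pair `(α₁, n)`; it exists and is unique if `ε > 0` and the completely mixed state is at
trace distance more than `ε` from `σ`, the only case in which it is used. -/
def lowPair (σ : State H) (ε : ℝ) : ℝ × ℕ :=
  Classical.epsilon fun x : ℝ × ℕ => IsLowLevel σ ε x.1 x.2

/-- The pair `(α₂, m)`; it exists and is unique if `ε > 0` and the completely mixed state is at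
trace distance more than `ε` from `σ`, the only case in which it is used. -/
def highPair (σ : State H) (ε : ℝ) : ℝ × ℕ :=
  Classical.epsilon fun x : ℝ × ℕ => IsHighLevel σ ε x.1 x.2

open Classical in
/-- The state `ρ*_ε(σ)` of maximal entropy in the `ε`-ball around `σ`. -/
def rhoMax (ε : ℝ) (σ : State H) : H →L[ℂ] H :=
  if ε = 0 then σ.1
  else if (1 / 2) * traceNorm (σ.1 - mixed H) ≤ ε then mixed H
  else diagOp σ fun j =>
    if j ≤ (highPair σ ε).2 then (highPair σ ε).1
    else if j ≤ Module.finrank ℂ H - (lowPair σ ε).2 then mu σ j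
    else (lowPair σ ε).1

/-- The sum `Q_l` of the `l` smallest eigenvalues of `σ`. -/
def tailSum (σ : State H) (l : ℕ) : ℝ :=
  ∑ j ∈ Finset.Icc (Module.finrank ℂ H - l + 1) (Module.finrank ℂ H), mu σ j

open Classical in
/-- The largest `l ∈ {0, …, d - 1}` with `Q_l ≤ ε`. -/
def cutIndex (ε : ℝ) (σ : State H) : ℕ :=
  Nat.findGreatest (fun l => tailSum σ l ≤ ε) (Module.finrank ℂ H - 1)

/-- The state `ρ_{*,ε}(σ)` of minimal entropy in the `ε`-ball around `σ`: the `l` smallest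
eigenvalues are set to zero, the next one is decreased by the remaining weight `ε - Q_l`, and the
largest one is increased by `ε`; if `l = d - 1`, all the weight goes to the largest one. For
`l = 0` only the smallest eigenvalue is decreased, by `ε`. -/
def rhoMin (ε : ℝ) (σ : State H) : H →L[ℂ] H :=
  diagOp σ fun j =>
    if cutIndex ε σ = Module.finrank ℂ H - 1 then (if j = 1 then 1 else 0)
    else if j = 1 then mu σ 1 + ε
    else if j < Module.finrank ℂ H - cutIndex ε σ then mu σ j
    else if j = Module.finrank ℂ H - cutIndex ε σ then mu σ j - (ε - tailSum σ (cutIndex ε σ))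
    else 0

/-- The local bound `max {S_α(ρ*_ε(σ)) - S_α(σ), S_α(σ) - S_α(ρ_{*,ε}(σ))}`. -/
def localBound (α ε : ℝ) (σ : State H) : ℝ :=
  max (renyi α (rhoMax ε σ) - renyi α σ.1) (renyi α σ.1 - renyi α (rhoMin ε σ))

/-- The constant `c_α = [ln 2 (1 - α)]⁻¹`. -/
def cConst (α : ℝ) : ℝ := (Real.log 2 * (1 - α))⁻¹

/-- `r_α(ε) = c_α (ε ^ α + (1 - ε) ^ α - 1)`. -/
def rFun (α ε : ℝ) : ℝ := cConst α * (ε ^ α + (1 - ε) ^ α - 1)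

/-- `g_α(x) = c_α (x ^ (1 - α) - 1)`. -/
def gFun (α x : ℝ) : ℝ := cConst α * (x ^ (1 - α) - 1)

/-- `η_α(x) = c_α (x ^ α - x)`. -/
def etaFun (α x : ℝ) : ℝ := cConst α * (x ^ α - x)

end RenyiBall

end

namespace RenyiBall

/-! Everything reduces to ordered spectra. By Ky Fan's principle the sum of the `k` largest
eigenvalues changes by at most the trace distance (`sum_mu_le_sum_mu_add`), so the spectrum of a
state in the ball has partial sums within `ε` of those of `σ`; nothing else about the state is used.
Partial sums of a decreasing sequence are concave, so they cannot drop below those of the flattened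
spectrum of `rhoMax` (`flatten_properties`). They cannot exceed those of the spectrum of `rhoMin`,
which equal the upper constraint until they reach `1` (`concentrate_properties`). Every spectrum in
the ball thus lies between these two in majorization order, and Schur concavity of the entropy gives
the local bound.

Both extremal spectra are within total variation `ε` of that of `σ`, so the explicit bounds only
concern two probability vectors `p`, `q` (`localBound_le`). For `α < 1`, below the threshold `α ^ (1
/ (1 - α))` the function `x ^ α - x` is its own modulus of continuity, and Jensen's inequality
bounds the sum over coordinates. For `α > 1`, a maximal coupling transports `q` to `p` and a
Fano-type argument bounds the difference of power sums. Logarithms are then compared by `log x ≤ x -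
1`. -/

/-! ### Functional calculus and traces in an eigenbasis -/

open Polynomial in
theorem aeval_apply_of_apply_eq_smul {H : Type*} [NormedAddCommGroup H] [InnerProductSpace ℂ H]
    {A : H →L[ℂ] H} {v : H} {r : ℝ} (h : A v = (r : ℂ) • v) (q : ℝ[X]) :
    (aeval A q) v = ((q.eval r : ℝ) : ℂ) • v := by
  induction q using Polynomial.induction_on' with
  | add p q hp hq => simp [hp, hq, add_smul]
  | monomial n a =>
    have hn : ∀ n : ℕ, (A ^ n) v = ((r ^ n : ℝ) : ℂ) • v := by
      intro n
      induction n with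
      | zero => simp
      | succ n ih =>
        rw [pow_succ', mul_apply_eq_comp, ih, map_smul, h, smul_smul]
        push_cast
        ring_nf
    rw [aeval_monomial, mul_apply_eq_comp, hn, Algebra.algebraMap_eq_smul_one]
    simp only [smul_apply, one_apply_eq_self, eval_monomial, Complex.ofReal_mul, mul_smul]
    rfl

/-- The polynomial with roots `δ i` annihilates `A`, so by spectral mapping it vanishes on the
spectrum. -/
theorem spectrum_real_subset_range {H : Type*} [NormedAddCommGroup H] [InnerProductSpace ℂ H]
    {n : ℕ} (b : OrthonormalBasis (Fin n) ℂ H) {A : H →L[ℂ] H} {δ : Fin n → ℝ}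
    (h : ∀ i, A (b i) = (δ i : ℂ) • b i) : spectrum ℝ A ⊆ Set.range δ := by
  intro x hx
  set p : Polynomial ℝ := ∏ i, (Polynomial.X - Polynomial.C (δ i)) with hp
  have h0 : Polynomial.aeval A p = 0 := by
    apply ContinuousLinearMap.coe_injective
    refine b.toBasis.ext fun i => ?_
    have := aeval_apply_of_apply_eq_smul (h i) p
    have hz : p.eval (δ i) = 0 := by
      rw [hp, Polynomial.eval_prod]
      exact Finset.prod_eq_zero (Finset.mem_univ i) (by simp)
    simpa [hz] using this
  have h1 := spectrum.subset_polynomial_aeval A p ⟨x, hx, rfl⟩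
  rw [h0] at h1
  have h2 : p.eval x = 0 := by
    by_contra hne
    refine h1 ?_
    rw [spectrum.mem_resolventSet_iff, sub_zero]
    exact (IsUnit.mk0 _ hne).map (algebraMap ℝ (H →L[ℂ] H))
  rw [hp, Polynomial.eval_prod, Finset.prod_eq_zero_iff] at h2
  obtain ⟨i, -, hi⟩ := h2
  exact ⟨i, by simp at hi; linarith⟩

theorem tr_eq_sum {H : Type*} [NormedAddCommGroup H] [InnerProductSpace ℂ H]
    {n : ℕ} (b : OrthonormalBasis (Fin n) ℂ H) {A : H →L[ℂ] H} {δ : Fin n → ℝ}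
    (h : ∀ i, A (b i) = (δ i : ℂ) • b i) : tr A = ((∑ i, δ i : ℝ) : ℂ) := by
  rw [tr, LinearMap.trace_eq_sum_inner _ b]
  push_cast
  refine Finset.sum_congr rfl fun i _ => ?_
  change inner ℂ (b i) (A (b i)) = _
  rw [h, inner_smul_right]
  simp

/-- The continuous functional calculus of a diagonalized operator acts on the eigenvalues. -/
theorem tr_cfc {H : Type*} [NormedAddCommGroup H] [InnerProductSpace ℂ H] [CompleteSpace H]
    {n : ℕ} (b : OrthonormalBasis (Fin n) ℂ H) {A : H →L[ℂ] H} (hA : IsSelfAdjoint A)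
    {δ : Fin n → ℝ} (h : ∀ i, A (b i) = (δ i : ℂ) • b i) (f : ℝ → ℝ) :
    tr (cfc f A) = ((∑ i, f (δ i) : ℝ) : ℂ) := by
  classical
  -- A polynomial agreeing with `f` on the finite set of eigenvalues has the same functional
  -- calculus, so `f` need not be continuous.
  set q := Lagrange.interpolate (Finset.univ.image δ) id f
  have hq : ∀ i, q.eval (δ i) = f (δ i) := fun i =>
    Lagrange.eval_interpolate_at_node (v := id) f Function.injective_id.injOn
      (Finset.mem_image_of_mem δ (Finset.mem_univ i))
  have hc : cfc f A = Polynomial.aeval A q := by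
    rw [← cfc_polynomial q A hA]
    refine cfc_congr fun x hx => ?_
    obtain ⟨i, rfl⟩ := spectrum_real_subset_range b h hx
    exact (hq i).symm
  rw [hc]
  refine tr_eq_sum b fun i => ?_
  rw [aeval_apply_of_apply_eq_smul (h i), hq]

theorem tr_rpow {H : Type*} [NormedAddCommGroup H] [InnerProductSpace ℂ H] [CompleteSpace H]
    {n : ℕ} (b : OrthonormalBasis (Fin n) ℂ H) {A : H →L[ℂ] H} (hA : A.IsPositive)
    {δ : Fin n → ℝ} (h : ∀ i, A (b i) = (δ i : ℂ) • b i) (α : ℝ) :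
    tr (A ^ α) = ((∑ i, δ i ^ α : ℝ) : ℂ) := by
  rw [CFC.rpow_eq_cfc_real ((ContinuousLinearMap.nonneg_iff_isPositive A).2 hA)]
  exact tr_cfc b hA.isSelfAdjoint h _

theorem traceNorm_eq_sum {H : Type*} [NormedAddCommGroup H] [InnerProductSpace ℂ H]
    [CompleteSpace H]
    {n : ℕ} (b : OrthonormalBasis (Fin n) ℂ H) {A : H →L[ℂ] H} (hA : IsSelfAdjoint A)
    {δ : Fin n → ℝ} (h : ∀ i, A (b i) = (δ i : ℂ) • b i) :
    traceNorm A = ∑ i, |δ i| := by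
  rw [traceNorm, CFC.abs_eq_cfc_norm A hA, tr_cfc b hA h]
  simp

/-! ### Eigenvalues of a state -/

section State

variable {H : Type*} [NormedAddCommGroup H] [InnerProductSpace ℂ H] [FiniteDimensional ℂ H]

theorem mu_succ (σ : State H) (i : Fin (Module.finrank ℂ H)) :
    mu σ (i.1 + 1) = σ.2.1.isSymmetric.eigenvalues rfl i := by
  rw [mu, dif_pos ⟨by omega, by omega⟩]
  rfl

theorem apply_eigenvectorBasis (σ : State H) (i : Fin (Module.finrank ℂ H)) :
    σ.1 (σ.2.1.isSymmetric.eigenvectorBasis rfl i) =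
      ((mu σ (i.1 + 1) : ℝ) : ℂ) • σ.2.1.isSymmetric.eigenvectorBasis rfl i := by
  rw [mu_succ]
  exact σ.2.1.isSymmetric.apply_eigenvectorBasis rfl i

theorem mu_nonneg (σ : State H) (j : ℕ) : 0 ≤ mu σ j := by
  rw [mu]
  split_ifs with h
  · exact LinearMap.IsPositive.nonneg_eigenvalues
      ((ContinuousLinearMap.isPositive_toLinearMap_iff _).2 σ.2.1) rfl _
  · exact le_rfl

/-- The default value `0` beyond the dimension lies below every eigenvalue, so monotonicity needs no
upper bound on the indices. Index `0` also carries the default value and must be excluded. -/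
theorem mu_antitone (σ : State H) {i j : ℕ} (hi : 1 ≤ i) (hij : i ≤ j) : mu σ j ≤ mu σ i := by
  by_cases hj : j ≤ Module.finrank ℂ H
  · rw [mu, mu, dif_pos ⟨by omega, hj⟩, dif_pos ⟨hi, by omega⟩]
    exact σ.2.1.isSymmetric.eigenvalues_antitone rfl (Fin.mk_le_mk.2 (by omega))
  · rw [mu, dif_neg (by omega)]
    exact mu_nonneg σ i

theorem sum_mu (σ : State H) : ∑ i ∈ Finset.range (Module.finrank ℂ H), mu σ (i + 1) = 1 := by
  have h := tr_eq_sum _ (apply_eigenvectorBasis σ)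
  rw [tr, σ.2.2] at h
  rw [← Fin.sum_univ_eq_sum_range (fun i => mu σ (i + 1))]
  exact_mod_cast h.symm

theorem finrank_pos (σ : State H) : 0 < Module.finrank ℂ H := by
  by_contra h
  have := sum_mu σ
  simp [Nat.eq_zero_of_not_pos h] at this

theorem diagOp_apply (σ : State H) (p : ℕ → ℝ) (i : Fin (Module.finrank ℂ H)) :
    diagOp σ p (σ.2.1.isSymmetric.eigenvectorBasis rfl i) =
      ((p (i.1 + 1) : ℝ) : ℂ) • σ.2.1.isSymmetric.eigenvectorBasis rfl i := by
  classical
  simp only [diagOp, sum_apply, smul_apply,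
    InnerProductSpace.rankOne_apply, OrthonormalBasis.inner_eq_ite]
  rw [Finset.sum_eq_single i]
  · simp
  · intro j _ hj
    simp [hj]
  · simp

theorem isPositive_diagOp [CompleteSpace H] (σ : State H) {p : ℕ → ℝ}
    (hp : ∀ i < Module.finrank ℂ H, 0 ≤ p (i + 1)) : (diagOp σ p).IsPositive := by
  refine ContinuousLinearMap.isPositive_sum _ fun i _ => ?_
  refine ContinuousLinearMap.IsPositive.smul_of_nonneg ?_ (by exact_mod_cast hp i i.2)
  exact InnerProductSpace.isPositive_rankOne_self _

end State

/-! ### Ky Fan's principle and the trace distance -/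

open Finset

/-- Relative to the level `x k`, full weight on the first `k` terms and none on the others is best;
the total weight `k` makes the level cancel. -/
theorem sum_mul_le_sum_range {d : ℕ} {x : ℕ → ℝ} (hx : Antitone x) {w : Fin d → ℝ}
    (hw : ∀ i, w i ∈ Set.Icc (0 : ℝ) 1) {k : ℕ} (hk : k ≤ d) (hs : ∑ i, w i = k) :
    ∑ i, w i * x i ≤ ∑ i ∈ range k, x i := by
  have h1 : ∑ i : Fin d, w i * (x i - x k) ≤
      ∑ i : Fin d, if (i : ℕ) < k then x i - x k else 0 := by
    refine sum_le_sum fun i _ => ?_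
    obtain ⟨h0, h1⟩ := hw i
    split_ifs with h
    · nlinarith [hx h.le]
    · nlinarith [hx (not_lt.1 h)]
  have h2 : (∑ i : Fin d, if (i : ℕ) < k then x i - x k else 0) =
      ∑ i ∈ range k, (x i - x k) := by
    rw [Fin.sum_univ_eq_sum_range (fun i => if i < k then x i - x k else 0) d, ← sum_filter]
    congr 1
    ext i
    simp only [mem_filter, mem_range]
    omega
  rw [h2] at h1
  simp only [mul_sub, sum_sub_distrib, ← sum_mul, hs, sum_const, card_range, nsmul_eq_mul] at h1
  linarith

/-- The compression of a diagonalizable operator to part of an orthonormal basis averages its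
eigenvalues with weights in `[0, 1]` of total weight the dimension of the compression. -/
theorem exists_weights {H : Type*} [NormedAddCommGroup H] [InnerProductSpace ℂ H] {n : ℕ}
    (u v : OrthonormalBasis (Fin n) ℂ H) {A : H →L[ℂ] H} {δ : Fin n → ℝ}
    (h : ∀ i, A (u i) = (δ i : ℂ) • u i) (s : Finset (Fin n)) :
    ∃ w : Fin n → ℝ, (∀ i, w i ∈ Set.Icc (0 : ℝ) 1) ∧ ∑ i, w i = #s ∧
      ∑ j ∈ s, (inner ℂ (v j) (A (v j))).re = ∑ i, w i * δ i := by
  refine ⟨fun i => ∑ j ∈ s, ‖inner ℂ (u i) (v j)‖ ^ 2, fun i => ⟨by positivity, ?_⟩, ?_, ?_⟩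
  · calc ∑ j ∈ s, ‖inner ℂ (u i) (v j)‖ ^ 2 ≤ ∑ j, ‖inner ℂ (u i) (v j)‖ ^ 2 :=
          sum_le_sum_of_subset_of_nonneg (subset_univ s) fun _ _ _ => by positivity
      _ = 1 := by
          rw [v.sum_sq_norm_inner_left, u.orthonormal.1 i, one_pow]
  · rw [sum_comm]
    simp [u.sum_sq_norm_inner_right]
  · simp only [sum_mul]
    rw [sum_comm]
    refine sum_congr rfl fun j _ => ?_
    have hA : A (v j) = ∑ i, (inner ℂ (u i) (v j) * δ i) • u i := by
      conv_lhs => rw [← u.sum_repr (v j)]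
      simp only [map_sum, map_smul, h, smul_smul, u.repr_apply_apply]
    rw [hA, inner_sum, Complex.re_sum]
    refine sum_congr rfl fun i _ => ?_
    rw [inner_smul_right, mul_right_comm, ← inner_conj_symm (v j) (u i), Complex.mul_conj,
      Complex.normSq_eq_norm_sq]
    norm_cast

theorem sum_abs_eq_two_mul_sum_max {ι : Type*} {s : Finset ι} {δ : ι → ℝ}
    (h : ∑ i ∈ s, δ i = 0) : ∑ i ∈ s, |δ i| = 2 * ∑ i ∈ s, max (δ i) 0 := by
  have : ∀ i, |δ i| = 2 * max (δ i) 0 - δ i := fun i => by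
    rcases le_total (δ i) 0 with h | h
    · rw [abs_of_nonpos h, max_eq_right h]; ring
    · rw [abs_of_nonneg h, max_eq_left h]; ring
  simp only [this, sum_sub_distrib, h, mul_sum, sub_zero]

/-- The sum of the `k` largest eigenvalues is Lipschitz for the trace distance. -/
theorem sum_mu_le_sum_mu_add {H : Type*} [NormedAddCommGroup H] [InnerProductSpace ℂ H]
    [FiniteDimensional ℂ H] [CompleteSpace H] (ω σ : State H) {k : ℕ}
    (hk : k ≤ Module.finrank ℂ H) :
    ∑ i ∈ range k, mu ω (i + 1) ≤
      ∑ i ∈ range k, mu σ (i + 1) + (1 / 2) * traceNorm (ω.1 - σ.1) := by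
  set d := Module.finrank ℂ H with hd
  have hΔ : IsSelfAdjoint (ω.1 - σ.1) := ω.2.1.isSelfAdjoint.sub σ.2.1.isSelfAdjoint
  have hΔs : ((ω.1 - σ.1 : H →L[ℂ] H) : H →ₗ[ℂ] H).IsSymmetric := hΔ.isSymmetric
  set v := ω.2.1.isSymmetric.eigenvectorBasis rfl
  set t := hΔs.eigenvectorBasis rfl
  set δ := hΔs.eigenvalues rfl
  have ht : ∀ i, (ω.1 - σ.1) (t i) = (δ i : ℂ) • t i := hΔs.apply_eigenvectorBasis rfl
  set s : Finset (Fin d) := univ.filter fun i => (i : ℕ) < k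
  have hs : #s = k := by
    simp only [s]
    rw [Fin.card_filter_val_lt]
    omega
  have hsum : ∑ j ∈ s, mu ω (j + 1) = ∑ i ∈ range k, mu ω (i + 1) := by
    simp only [s, sum_filter]
    rw [Fin.sum_univ_eq_sum_range (fun i => if i < k then mu ω (i + 1) else 0) d, ← sum_filter]
    congr 1
    ext i
    simp only [mem_filter, mem_range]
    omega
  -- Write `ω = σ + (ω - σ)` and compress to the top `k` eigenvectors of `ω`. The first term is at
  -- most the top `k` eigenvalues of `σ`. The second is at most the positive part of the traceless
  -- operator `ω - σ`, whose trace is half the trace norm.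
  obtain ⟨w, hw, hwk, hws⟩ := exists_weights _ v (apply_eigenvectorBasis σ) s
  obtain ⟨z, hz, hzk, hzs⟩ := exists_weights t v ht s
  have h1 : ∑ i, w i * mu σ (i + 1) ≤ ∑ i ∈ range k, mu σ (i + 1) :=
    sum_mul_le_sum_range (fun i j hij => mu_antitone σ (by omega) (by omega)) hw hk
      (by rw [hwk, hs])
  have h0 : ∑ i, δ i = 0 := by
    have h := tr_eq_sum t ht
    have h' : tr (ω.1 - σ.1) = 0 := by
      change LinearMap.trace ℂ H ((ω.1 : H →ₗ[ℂ] H) - (σ.1 : H →ₗ[ℂ] H)) = 0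
      rw [map_sub, ω.2.2, σ.2.2, sub_self]
    rw [h'] at h
    exact_mod_cast h.symm
  have h2 : ∑ i, z i * δ i ≤ (1 / 2) * traceNorm (ω.1 - σ.1) := by
    rw [traceNorm_eq_sum t hΔ ht, sum_abs_eq_two_mul_sum_max h0]
    calc ∑ i, z i * δ i ≤ ∑ i, max (δ i) 0 := sum_le_sum fun i _ => by
          obtain ⟨a, b⟩ := hz i
          nlinarith [le_max_left (δ i) 0, le_max_right (δ i) 0]
      _ = _ := by ring
  have h3 : ∑ j ∈ s, mu ω (j + 1) =
      ∑ j ∈ s, (inner ℂ (v j) (σ.1 (v j))).re +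
        ∑ j ∈ s, (inner ℂ (v j) ((ω.1 - σ.1) (v j))).re := by
    rw [← sum_add_distrib]
    refine sum_congr rfl fun j _ => ?_
    have := apply_eigenvectorBasis ω j
    rw [sub_apply, inner_sub_right, this, inner_smul_right]
    have hv : (inner ℂ (v j) (v j)) = 1 := by simp
    simp only [v] at hv ⊢
    rw [hv]
    simp
  rw [← hsum, h3, hws, hzs]
  linarith

/-! ### Karamata's inequality for powers -/

/-- Abel summation: each step from `c n` down to `c (n + 1)` meets a nonnegative partial sum, and
the boundary term vanishes. -/
theorem sum_mul_nonneg_of_antitone {d : ℕ} {c x : ℕ → ℝ}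
    (hc : ∀ i, i + 1 < d → c (i + 1) ≤ c i) (hx : ∀ k ≤ d, 0 ≤ ∑ i ∈ range k, x i)
    (h0 : ∑ i ∈ range d, x i = 0) : 0 ≤ ∑ i ∈ range d, c i * x i := by
  have key : ∀ n, n + 1 ≤ d →
      c n * ∑ i ∈ range (n + 1), x i ≤ ∑ i ∈ range (n + 1), c i * x i := by
    intro n
    induction n with
    | zero => simp
    | succ n ih =>
      intro hn
      rw [sum_range_succ, sum_range_succ (fun i => c i * x i)]
      have h1 := ih (by omega)
      have h2 := mul_le_mul_of_nonneg_right (hc n hn) (hx (n + 1) (by omega))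
      linarith
  cases d with
  | zero => simp
  | succ d =>
    have := key d le_rfl
    rwa [h0, mul_zero] at this

/-- Karamata's inequality for a function with a monotone choice `g` of tangent slopes. -/
theorem sum_le_sum_of_majorized {d : ℕ} {p q : ℕ → ℝ} {f g : ℝ → ℝ}
    (hp : ∀ i, i + 1 < d → p (i + 1) ≤ p i) (hp0 : ∀ i < d, 0 ≤ p i) (hq0 : ∀ i < d, 0 ≤ q i)
    (hle : ∀ k ≤ d, ∑ i ∈ range k, p i ≤ ∑ i ∈ range k, q i)
    (heq : ∑ i ∈ range d, p i = ∑ i ∈ range d, q i)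
    (hf : ∀ x y, 0 ≤ x → 0 ≤ y → f x + g x * (y - x) ≤ f y)
    (hg : ∀ x y, 0 ≤ x → x ≤ y → g x ≤ g y) :
    ∑ i ∈ range d, f (p i) ≤ ∑ i ∈ range d, f (q i) := by
  have h1 : 0 ≤ ∑ i ∈ range d, g (p i) * (q i - p i) := by
    refine sum_mul_nonneg_of_antitone (c := fun i => g (p i)) (x := fun i => q i - p i)
      (fun i hi => hg _ _ (hp0 _ hi) (hp i hi)) (fun k hk => ?_) ?_
    · rw [sum_sub_distrib]
      linarith [hle k hk]
    · rw [sum_sub_distrib, heq, sub_self]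
  have h2 : ∑ i ∈ range d, (f (p i) + g (p i) * (q i - p i)) ≤ ∑ i ∈ range d, f (q i) :=
    sum_le_sum fun i hi => hf _ _ (hp0 i (mem_range.1 hi)) (hq0 i (mem_range.1 hi))
  rw [sum_add_distrib] at h2
  linarith

/-- Bernoulli's inequality at `y / x - 1`. Positivity of `x` is essential for `α < 1`, where the
slope at `0` is infinite. -/
theorem rpow_le_tangent {α x y : ℝ} (h0 : 0 ≤ α) (h1 : α ≤ 1) (hx : 0 < x) (hy : 0 ≤ y) :
    y ^ α ≤ x ^ α + α * x ^ (α - 1) * (y - x) := by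
  have h := rpow_one_add_le_one_add_mul_self (s := y / x - 1) (p := α)
    (by have := div_nonneg hy hx.le; linarith) h0 h1
  rw [add_sub_cancel, Real.div_rpow hy hx.le, div_le_iff₀ (by positivity)] at h
  rw [Real.rpow_sub_one hx.ne']
  calc y ^ α ≤ _ := h
    _ = _ := by field_simp

theorem tangent_le_rpow {α x y : ℝ} (h1 : 1 < α) (hx : 0 ≤ x) (hy : 0 ≤ y) :
    x ^ α + α * x ^ (α - 1) * (y - x) ≤ y ^ α := by
  rcases hx.eq_or_lt with rfl | hx
  · rw [Real.zero_rpow (by linarith), Real.zero_rpow (by linarith)]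
    simpa using Real.rpow_nonneg hy α
  have h := one_add_mul_self_le_rpow_one_add (s := y / x - 1) (p := α)
    (by have := div_nonneg hy hx.le; linarith) h1.le
  rw [add_sub_cancel, Real.div_rpow hy hx.le, le_div_iff₀ (by positivity)] at h
  rw [Real.rpow_sub_one hx.ne']
  calc _ = _ := by field_simp
    _ ≤ y ^ α := h

theorem sum_rpow_le_of_majorized {d : ℕ} {p q : ℕ → ℝ} {α : ℝ} (hα : 1 < α)
    (hp : ∀ i, i + 1 < d → p (i + 1) ≤ p i) (hp0 : ∀ i < d, 0 ≤ p i) (hq0 : ∀ i < d, 0 ≤ q i)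
    (hle : ∀ k ≤ d, ∑ i ∈ range k, p i ≤ ∑ i ∈ range k, q i)
    (heq : ∑ i ∈ range d, p i = ∑ i ∈ range d, q i) :
    ∑ i ∈ range d, p i ^ α ≤ ∑ i ∈ range d, q i ^ α := by
  refine sum_le_sum_of_majorized (f := fun x => x ^ α) (g := fun x => α * x ^ (α - 1))
    hp hp0 hq0 hle heq (fun x y hx hy => tangent_le_rpow hα hx hy) fun x y hx hxy => ?_
  exact mul_le_mul_of_nonneg_left (Real.rpow_le_rpow hx hxy (by linarith)) (by linarith)

theorem sum_rpow_ge_of_majorized {d : ℕ} {p q : ℕ → ℝ} {α : ℝ} (h0 : 0 < α) (h1 : α < 1)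
    (hp : ∀ i, i + 1 < d → p (i + 1) ≤ p i) (hp0 : ∀ i < d, 0 ≤ p i) (hq0 : ∀ i < d, 0 ≤ q i)
    (hle : ∀ k ≤ d, ∑ i ∈ range k, p i ≤ ∑ i ∈ range k, q i)
    (heq : ∑ i ∈ range d, p i = ∑ i ∈ range d, q i) :
    ∑ i ∈ range d, q i ^ α ≤ ∑ i ∈ range d, p i ^ α := by
  -- Shifting by `δ` avoids the infinite slope at `0`; continuity then allows `δ → 0`.
  have key : ∀ δ : ℝ, 0 < δ → ∑ i ∈ range d, (q i + δ) ^ α ≤ ∑ i ∈ range d, (p i + δ) ^ α := by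
    intro δ hδ
    have := sum_le_sum_of_majorized (f := fun x => -(x + δ) ^ α)
      (g := fun x => -(α * (x + δ) ^ (α - 1))) hp hp0 hq0 hle heq
      (fun x y hx hy => by
        have := rpow_le_tangent h0.le h1.le (x := x + δ) (y := y + δ) (by positivity)
          (by positivity)
        rw [add_sub_add_right_eq_sub] at this
        linarith)
      (fun x y hx hxy => by
        have := Real.rpow_le_rpow_of_nonpos (z := α - 1) (x := x + δ) (y := y + δ)
          (by positivity) (by linarith) (by linarith)
        have := mul_le_mul_of_nonneg_left this h0.le
        linarith)
    simpa using this
  have lim : ∀ r : ℕ → ℝ, Filter.Tendsto (fun δ : ℝ => ∑ i ∈ range d, (r i + δ) ^ α)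
      (nhdsWithin 0 (Set.Ioi 0)) (nhds (∑ i ∈ range d, r i ^ α)) := by
    intro r
    have hc : Continuous fun δ : ℝ => ∑ i ∈ range d, (r i + δ) ^ α :=
      continuous_finsetSum _ fun i _ =>
        (continuous_const.add continuous_id).rpow_const fun _ => Or.inr h0.le
    have := hc.tendsto 0
    simp only [add_zero] at this
    exact this.mono_left nhdsWithin_le_nhds
  exact le_of_tendsto_of_tendsto (lim q) (lim p)
    (eventually_nhdsWithin_of_forall fun δ hδ => key δ hδ)

/-! ### Total variation bound for `α < 1` -/

/-- The threshold is the maximum point of `x ^ α - x`. For positive `h`, the conclusion says that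
its derivative at `h` is nonnegative. -/
theorem le_mul_rpow_of_le {α h : ℝ} (h0 : 0 < α) (h1 : α < 1) (hh : 0 ≤ h)
    (hle : h ≤ α ^ (1 / (1 - α))) : h ≤ α * h ^ α := by
  have h2 : h ^ (1 - α) ≤ α := by
    have := Real.rpow_le_rpow hh hle (show 0 ≤ 1 - α by linarith)
    rwa [← Real.rpow_mul h0.le, one_div_mul_cancel (by linarith), Real.rpow_one] at this
  calc h = h ^ (1 - α) * h ^ α := by
        rw [← Real.rpow_add_of_nonneg hh (by linarith) h0.le]
        simp
    _ ≤ α * h ^ α := mul_le_mul_of_nonneg_right h2 (Real.rpow_nonneg hh _)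

/-- By `log α ≤ α - 1` the threshold is at most `1 / e`. This yields `2 * ε ≤ 1`, needed in
dimension one. -/
theorem rpow_one_div_one_sub_le_half {α : ℝ} (h0 : 0 < α) (h1 : α < 1) :
    α ^ (1 / (1 - α)) ≤ 1 / 2 := by
  have hα : 0 < 1 - α := by linarith
  have h2 : Real.log α * (1 / (1 - α)) ≤ -1 := by
    rw [mul_one_div, div_le_iff₀ hα]
    linarith [Real.log_le_sub_one_of_pos h0]
  rw [Real.rpow_def_of_pos h0]
  calc Real.exp (Real.log α * (1 / (1 - α))) ≤ Real.exp (-1) := Real.exp_le_exp.2 h2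
    _ ≤ 1 / 2 := by
      rw [Real.exp_neg, one_div]
      exact inv_anti₀ two_pos (by linarith [Real.add_one_le_exp (1 : ℝ)])

/-- The modulus of continuity of `x ^ α - x`. -/
theorem rpow_sub_le_rpow_abs_sub {α x y : ℝ} (h0 : 0 < α) (h1 : α < 1) (hx : 0 ≤ x) (hy : 0 ≤ y)
    (hy1 : y ≤ 1) (hle : |x - y| ≤ α * |x - y| ^ α) :
    (x ^ α - x) - (y ^ α - y) ≤ |x - y| ^ α - |x - y| := by
  rcases le_or_gt y x with h | h
  · rw [abs_of_nonneg (sub_nonneg.2 h)] at hle ⊢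
    have := Real.rpow_add_le_add_rpow hy (sub_nonneg.2 h) h0.le h1.le
    rw [add_sub_cancel] at this
    linarith
  · rw [abs_of_neg (sub_neg.2 h), neg_sub] at hle ⊢
    have hyp : 0 < y := hx.trans_lt h
    -- With `h = y - x`, the tangent at `y ≤ 1` gives `x ^ α - y ^ α ≤ -α * h`. It remains to see
    -- `(2 - α) * h ≤ h ^ α`, which follows from `h ≤ α * h ^ α` and `(2 - α) * α = 1 - (1 - α) ^ 2
    -- ≤ 1`.
    have h2 := rpow_le_tangent h0.le h1.le hyp hx
    have h3 : 1 ≤ y ^ (α - 1) := Real.one_le_rpow_of_pos_of_le_one_of_nonpos hyp hy1 (by linarith)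
    have h4 : (y - x) ≤ y ^ (α - 1) * (y - x) := le_mul_of_one_le_left (by linarith) h3
    have h5 := mul_le_mul_of_nonneg_left h4 h0.le
    have h6 := mul_le_mul_of_nonneg_left hle (show 0 ≤ 2 - α by linarith)
    have h7 : 0 ≤ (y - x) ^ α := Real.rpow_nonneg (by linarith) _
    nlinarith [mul_nonneg h7 (sq_nonneg (1 - α))]

theorem abs_le_half_sum_abs {ι : Type*} [Fintype ι] {δ : ι → ℝ} (h : ∑ i, δ i = 0) (i : ι) :
    |δ i| ≤ (1 / 2) * ∑ j, |δ j| := by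
  classical
  rw [← add_sum_erase _ _ (mem_univ i)] at h
  have h1 := abs_sum_le_sum_abs δ (univ.erase i)
  rw [show ∑ j ∈ univ.erase i, δ j = -δ i by linarith, abs_neg] at h1
  rw [← add_sum_erase _ _ (mem_univ i)]
  linarith

/-- Continuity of `∑ p ^ α` in total variation for `α < 1`. -/
theorem sum_rpow_sub_le_of_lt_one {ι : Type*} [Fintype ι] {α ε : ℝ} (h0 : 0 < α) (h1 : α < 1)
    (hε0 : 0 ≤ ε) (hε : ε < α ^ (1 / (1 - α))) {p q : ι → ℝ} (hp0 : ∀ i, 0 ≤ p i)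
    (hq0 : ∀ i, 0 ≤ q i) (hp : ∑ i, p i = 1) (hq : ∑ i, q i = 1)
    (hpq : (1 / 2) * ∑ i, |p i - q i| ≤ ε) :
    ∑ i, p i ^ α - ∑ i, q i ^ α ≤
      (Fintype.card ι : ℝ) ^ (1 - α) * (2 * ε) ^ α - 2 * ε := by
  have hsum : ∑ i, (p i - q i) = 0 := by rw [sum_sub_distrib, hp, hq, sub_self]
  have hle : ∀ i, |p i - q i| ≤ ε := fun i => (abs_le_half_sum_abs hsum i).trans hpq
  have hη : ∑ i, p i ^ α - ∑ i, q i ^ α ≤ ∑ i, (|p i - q i| ^ α - |p i - q i|) := by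
    have : ∑ i, ((p i ^ α - p i) - (q i ^ α - q i)) ≤ ∑ i, (|p i - q i| ^ α - |p i - q i|) :=
      sum_le_sum fun i _ => rpow_sub_le_rpow_abs_sub h0 h1 (hp0 i) (hq0 i)
        (hq ▸ single_le_sum (fun j _ => hq0 j) (mem_univ i))
        (le_mul_rpow_of_le h0 h1 (abs_nonneg _) ((hle i).trans hε.le))
    simp only [sum_sub_distrib, hp, hq] at this ⊢
    linarith
  rcases hε0.eq_or_lt with rfl | hεp
  · have hz : ∀ i, |p i - q i| = 0 := fun i => le_antisymm (hle i) (abs_nonneg _)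
    simpa [hz, Real.zero_rpow h0.ne'] using hη
  set d := Fintype.card ι with hd
  have hdpos : 0 < d := by
    rw [hd, Fintype.card_pos_iff]
    by_contra hne
    rw [not_nonempty_iff] at hne
    simp at hp
  have hd0 : (0 : ℝ) < d := by exact_mod_cast hdpos
  -- `v` is the mean of `|p i - q i|` when the distance is exactly `ε`; the tangent at `v` gives
  -- Jensen's inequality.
  set v := 2 * ε / d with hv
  have hvpos : 0 < v := by positivity
  have hdv : d * v = 2 * ε := by rw [hv]; field_simp
  have hdvα : (d : ℝ) ^ (1 - α) * (2 * ε) ^ α = d * v ^ α := by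
    rw [hv, Real.div_rpow (by positivity) hd0.le, Real.rpow_sub hd0, Real.rpow_one]
    ring
  rw [hdvα]
  rcases Nat.lt_or_ge 1 d with hd2 | hd2
  · have hd2' : (2 : ℝ) ≤ d := by exact_mod_cast hd2
    have hvε : v ≤ ε := by
      rw [hv, div_le_iff₀ hd0]
      nlinarith
    -- Since `v ≤ ε` is below the threshold, the tangent of `x ^ α - x` at `v` is nondecreasing, so
    -- a distance smaller than `ε` only lowers the bound.
    have hslope : 1 ≤ α * v ^ (α - 1) := by
      rw [Real.rpow_sub_one hvpos.ne', ← mul_div_assoc, le_div_iff₀ hvpos, one_mul]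
      exact le_mul_rpow_of_le h0 h1 hvpos.le (hvε.trans hε.le)
    have hT : ∑ i, (|p i - q i| ^ α - |p i - q i|) ≤
        ∑ i, (v ^ α + α * v ^ (α - 1) * (|p i - q i| - v) - |p i - q i|) :=
      sum_le_sum fun i _ => sub_le_sub_right
        (rpow_le_tangent h0.le h1.le hvpos (abs_nonneg _)) _
    have hE : ∑ i, (v ^ α + α * v ^ (α - 1) * (|p i - q i| - v) - |p i - q i|) =
        d * v ^ α + α * v ^ (α - 1) * (∑ i, |p i - q i| - 2 * ε) - ∑ i, |p i - q i| := by
      rw [sum_sub_distrib, sum_add_distrib, ← mul_sum, sum_sub_distrib]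
      simp only [sum_const, card_univ, nsmul_eq_mul, ← hd, hdv]
    rw [hE] at hT
    nlinarith [mul_nonneg (sub_nonneg.2 hslope) (show 0 ≤ 2 * ε - ∑ i, |p i - q i| by linarith)]
  -- In dimension one `v = 2 * ε` may exceed the threshold, but `p = q` and the bound only has to be
  -- nonnegative.
  · have hd1 : Fintype.card ι = 1 := by omega
    obtain ⟨a, ha⟩ := Fintype.card_eq_one_iff.1 hd1
    have hz : ∀ i, |p i - q i| = 0 := by
      have hu : (univ : Finset ι) = {a} := by
        ext i
        simp [ha i]
      intro i
      rw [hu, sum_singleton] at hsum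
      rw [ha i, hsum, abs_zero]
    have hv1 : v ≤ 1 := by
      have hh := rpow_one_div_one_sub_le_half h0 h1
      have hd1' : (d : ℝ) = 1 := by exact_mod_cast hd1
      rw [hv, hd1']
      linarith
    have hvα : v ≤ v ^ α := by
      conv_lhs => rw [← Real.rpow_one v]
      exact Real.rpow_le_rpow_of_exponent_ge hvpos hv1 h1.le
    simp only [hz, Real.zero_rpow h0.ne', sub_zero, sum_const_zero] at hη
    nlinarith [mul_le_mul_of_nonneg_left hvα hd0.le]

/-! ### A Fano inequality for `α > 1` -/

/-- The largest value of `1 - ∑ m ^ α` over probability vectors `m` of length `d` one of whose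
entries is `1 - e`. -/
noncomputable def fanoFun (α d e : ℝ) : ℝ := 1 - (1 - e) ^ α - e ^ α * (d - 1) ^ (1 - α)

theorem sum_rpow_le_rpow_sum {ι : Type*} (s : Finset ι) {f : ι → ℝ} {α : ℝ} (hα : 1 ≤ α)
    (hf : ∀ i ∈ s, 0 ≤ f i) : ∑ i ∈ s, f i ^ α ≤ (∑ i ∈ s, f i) ^ α := by
  classical
  induction s using Finset.induction_on with
  | empty => simp [Real.zero_rpow (show α ≠ 0 by linarith)]
  | insert a s ha ih =>
    rw [sum_insert ha, sum_insert ha]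
    have h1 := ih fun i hi => hf i (mem_insert_of_mem hi)
    have h2 := Real.add_rpow_le_rpow_add (hf a (mem_insert_self a s))
      (sum_nonneg fun i hi => hf i (mem_insert_of_mem hi)) hα
    linarith

/-- By the power mean inequality, `∑ m ^ α` with `m y` fixed is least when the rest is spread evenly
over the other entries. -/
theorem one_sub_sum_rpow_le_fanoFun {ι : Type*} [Fintype ι] {α : ℝ} (hα : 1 < α)
    (hd : 2 ≤ Fintype.card ι) {m : ι → ℝ} (hm0 : ∀ i, 0 ≤ m i) (hm : ∑ i, m i = 1) (y : ι) :
    1 - ∑ i, m i ^ α ≤ fanoFun α (Fintype.card ι) (1 - m y) := by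
  classical
  have hd' : (2 : ℝ) ≤ Fintype.card ι := by exact_mod_cast hd
  have hpos : (0 : ℝ) < (Fintype.card ι : ℝ) - 1 := by linarith
  have hc : ((#(univ.erase y) : ℕ) : ℝ) = (Fintype.card ι : ℝ) - 1 := by
    rw [card_erase_of_mem (mem_univ y), card_univ, Nat.cast_sub (by omega), Nat.cast_one]
  have h1 := Real.rpow_sum_le_const_mul_sum_rpow_of_nonneg (univ.erase y) (f := m) hα.le
    fun i _ => hm0 i
  have hs : ∑ i ∈ univ.erase y, m i = 1 - m y := by
    rw [← hm, ← add_sum_erase _ _ (mem_univ y)]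
    ring
  rw [hs, hc] at h1
  have h2 := mul_le_mul_of_nonneg_right h1 (Real.rpow_nonneg hpos.le (1 - α))
  have h3 : ((Fintype.card ι : ℝ) - 1) ^ (α - 1) * ((Fintype.card ι : ℝ) - 1) ^ (1 - α) = 1 := by
    rw [← Real.rpow_add hpos]
    simp
  rw [mul_right_comm, h3, one_mul] at h2
  rw [← add_sum_erase _ _ (mem_univ y), fanoFun, sub_sub_cancel]
  linarith

theorem concaveOn_fanoFun {α d : ℝ} (hα : 1 < α) (hd : 1 ≤ d) :
    ConcaveOn ℝ (Set.Icc 0 1) (fanoFun α d) := by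
  have hc := (convexOn_rpow hα.le)
  have h1 : ConvexOn ℝ (Set.Icc (0 : ℝ) 1) fun e : ℝ => e ^ α :=
    hc.subset (fun x hx => hx.1) (convex_Icc _ _)
  have h2 : ConvexOn ℝ (Set.Icc (0 : ℝ) 1) fun e : ℝ => (1 - e) ^ α := by
    refine ⟨convex_Icc _ _, fun x hx y hy a b ha hb hab => ?_⟩
    have := hc.2 (x := 1 - x) (y := 1 - y) (sub_nonneg.2 hx.2) (sub_nonneg.2 hy.2) ha hb hab
    simp only [smul_eq_mul] at this ⊢
    rwa [show a * (1 - x) + b * (1 - y) = 1 - (a * x + b * y) by linear_combination hab] at this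
  have h3 := h1.smul (Real.rpow_nonneg (sub_nonneg.2 hd) (1 - α))
  have h4 := ((h2.add h3).neg).add_const 1
  refine h4.congr fun e _ => ?_
  simp only [fanoFun, Pi.neg_apply, Pi.add_apply, smul_eq_mul]
  ring

/-- The vector with one entry `1 - e` and `d - 1` entries `e / (d - 1)` has mean `1 / d`; Jensen's
inequality compares it with the uniform one, which is the case `e = 1 - 1 / d`. -/
theorem fanoFun_le_fanoFun_max {α d e : ℝ} (hα : 1 < α) (hd : 1 < d) (he : e ∈ Set.Icc (0 : ℝ) 1) :
    fanoFun α d e ≤ fanoFun α d (1 - 1 / d) := by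
  have hd0 : 0 < d := by linarith
  have hd1 : 0 < d - 1 := by linarith
  have h := (convexOn_rpow hα.le).2 (show 1 - e ∈ Set.Ici 0 from sub_nonneg.2 he.2)
    (show e / (d - 1) ∈ Set.Ici 0 from div_nonneg he.1 hd1.le) (show 0 ≤ 1 / d by positivity)
    (show 0 ≤ (d - 1) / d by positivity) (by field_simp; ring)
  simp only [smul_eq_mul] at h
  rw [show 1 / d * (1 - e) + (d - 1) / d * (e / (d - 1)) = 1 / d by field_simp; ring,
    Real.div_rpow he.1 hd1.le] at h
  have hs : (d - 1) ^ (1 - α) = (d - 1) / (d - 1) ^ α := by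
    rw [Real.rpow_sub hd1, Real.rpow_one]
  have h2 := mul_le_mul_of_nonneg_left h hd0.le
  have h3 : d * (1 / d * (1 - e) ^ α + (d - 1) / d * (e ^ α / (d - 1) ^ α)) =
      (1 - e) ^ α + e ^ α * (d - 1) ^ (1 - α) := by
    rw [hs]
    field_simp
  have h4 : (1 / d) ^ α + (1 - 1 / d) ^ α * (d - 1) ^ (1 - α) = d * (1 / d) ^ α := by
    rw [hs, show 1 - 1 / d = (1 / d) * (d - 1) by field_simp,
      Real.mul_rpow (by positivity) hd1.le]
    have := (Real.rpow_pos_of_pos hd1 α).ne'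
    field_simp
    ring
  simp only [fanoFun, sub_sub_cancel]
  linarith

/-- A concave function is nondecreasing to the left of a maximum point: `t` is a convex combination
of `s` and `1 - 1 / d`. -/
theorem fanoFun_mono {α d s t : ℝ} (hα : 1 < α) (hd : 1 < d) (hs : 0 ≤ s) (hst : s ≤ t)
    (ht : t ≤ 1 - 1 / d) : fanoFun α d s ≤ fanoFun α d t := by
  have hd0 : 0 < 1 / d := by positivity
  rcases hst.eq_or_lt with rfl | hst
  · exact le_rfl
  have hden : 0 < 1 - 1 / d - s := by linarith
  have h := (concaveOn_fanoFun hα hd.le).2 (show s ∈ Set.Icc 0 1 from ⟨hs, by linarith⟩)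
    (show 1 - 1 / d ∈ Set.Icc 0 1 from ⟨by linarith, by linarith⟩)
    (show 0 ≤ (1 - 1 / d - t) / (1 - 1 / d - s) from div_nonneg (by linarith) hden.le)
    (show 0 ≤ (t - s) / (1 - 1 / d - s) from div_nonneg (by linarith) hden.le)
    (by rw [← add_div, div_eq_one_iff_eq hden.ne']; ring)
  simp only [smul_eq_mul] at h
  rw [show (1 - 1 / d - t) / (1 - 1 / d - s) * s + (t - s) / (1 - 1 / d - s) * (1 - 1 / d) = t by
    rw [div_mul_eq_mul_div, div_mul_eq_mul_div, ← add_div, div_eq_iff hden.ne']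
    ring] at h
  have hm := fanoFun_le_fanoFun_max hα hd (e := s) ⟨hs, by linarith⟩
  have hb : 0 ≤ (t - s) / (1 - 1 / d - s) := div_nonneg (by linarith) hden.le
  have ha : (1 - 1 / d - t) / (1 - 1 / d - s) = 1 - (t - s) / (1 - 1 / d - s) := by
    rw [eq_sub_iff_add_eq, ← add_div, div_eq_one_iff_eq hden.ne']
    ring
  rw [ha] at h
  nlinarith [mul_le_mul_of_nonneg_left hm hb]

/-- A Fano inequality for `∑ p ^ α`, with `α > 1`, where `p` is the image of `q` under the
stochastic matrix `M`. -/
theorem sum_rpow_sub_le_of_stochastic {ι : Type*} [Fintype ι] {α : ℝ} (hα : 1 < α)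
    (hd : 2 ≤ Fintype.card ι) {p q : ι → ℝ} {M : ι → ι → ℝ} (hq0 : ∀ i, 0 ≤ q i)
    (hq : ∑ i, q i = 1) (hM0 : ∀ y x, 0 ≤ M y x) (hM : ∀ y, ∑ x, M y x = 1)
    (hMp : ∀ x, ∑ y, q y * M y x = p x) :
    ∑ i, q i ^ α - ∑ i, p i ^ α ≤
      fanoFun α (Fintype.card ι) (∑ y, q y * (1 - M y y)) := by
  have hd' : (2 : ℝ) ≤ Fintype.card ι := by exact_mod_cast hd
  have hM1 : ∀ y x, M y x ≤ 1 := fun y x => hM y ▸ single_le_sum (fun j _ => hM0 y j) (mem_univ x)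
  have hq1 : ∀ y, q y ≤ 1 := fun y => hq ▸ single_le_sum (fun j _ => hq0 j) (mem_univ y)
  -- Superadditivity of `x ^ α` applied to `p x = ∑ y, q y * M y x`.
  have h1 : ∑ y, q y ^ α * ∑ x, M y x ^ α ≤ ∑ x, p x ^ α := by
    simp only [mul_sum]
    rw [sum_comm]
    refine sum_le_sum fun x _ => ?_
    rw [← hMp x]
    refine le_trans (le_of_eq ?_)
      (sum_rpow_le_rpow_sum univ hα.le fun y _ => mul_nonneg (hq0 y) (hM0 y x))
    exact sum_congr rfl fun y _ => (Real.mul_rpow (hq0 y) (hM0 y x)).symm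
  have h2 : ∀ y, q y ^ α * (1 - ∑ x, M y x ^ α) ≤
      q y * fanoFun α (Fintype.card ι) (1 - M y y) := by
    intro y
    have hle : q y ^ α ≤ q y := by
      simpa using Real.rpow_le_rpow_of_exponent_ge' (hq0 y) (hq1 y) zero_le_one hα.le
    have hnn : 0 ≤ 1 - ∑ x, M y x ^ α := by
      have := sum_rpow_le_rpow_sum univ hα.le fun x _ => hM0 y x
      rw [hM y, Real.one_rpow] at this
      linarith
    calc q y ^ α * (1 - ∑ x, M y x ^ α) ≤ q y * (1 - ∑ x, M y x ^ α) :=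
          mul_le_mul_of_nonneg_right hle hnn
      _ ≤ _ := mul_le_mul_of_nonneg_left
          (one_sub_sum_rpow_le_fanoFun hα hd (hM0 y) (hM y) y) (hq0 y)
  -- Jensen's inequality with weights `q` collects the row errors `1 - M y y` into the average
  -- error.
  have h3 := (concaveOn_fanoFun hα (show (1 : ℝ) ≤ Fintype.card ι by linarith)).le_map_sum
    (t := univ) (w := q) (p := fun y => 1 - M y y) (fun y _ => hq0 y) hq
    (fun y _ => ⟨by linarith [hM1 y y], by linarith [hM0 y y]⟩)
  simp only [smul_eq_mul] at h3
  have h4 := sum_le_sum fun y (_ : y ∈ univ) => h2 y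
  simp only [mul_sub, mul_one, sum_sub_distrib] at h4 h3 ⊢
  linarith

/-- The stochastic matrix is that of a maximal coupling: it moves only the excess of `q` over `p`,
and distributes it in proportion to the excess of `p` over `q`. Its average error is exactly the
total variation distance. -/
theorem sum_rpow_sub_le_fanoFun {ι : Type*} [Fintype ι] {α : ℝ} (hα : 1 < α)
    (hd : 2 ≤ Fintype.card ι) {p q : ι → ℝ} (hp0 : ∀ i, 0 ≤ p i)
    (hq0 : ∀ i, 0 ≤ q i) (hp : ∑ i, p i = 1) (hq : ∑ i, q i = 1) :
    ∑ i, q i ^ α - ∑ i, p i ^ α ≤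
      fanoFun α (Fintype.card ι) ((1 / 2) * ∑ i, |p i - q i|) := by
  classical
  set t := (1 / 2) * ∑ i, |p i - q i| with ht
  have hpos : ∑ i, max (p i - q i) 0 = t := by
    have h : ∀ i, max (p i - q i) 0 = (1 / 2) * |p i - q i| + (1 / 2) * (p i - q i) := fun i => by
      rcases le_total (p i - q i) 0 with h | h
      · rw [max_eq_right h, abs_of_nonpos h]; ring
      · rw [max_eq_left h, abs_of_nonneg h]; ring
    simp only [h, sum_add_distrib, ← mul_sum, sum_sub_distrib, hp, hq, ht]
    ring
  have hneg : ∑ i, max (q i - p i) 0 = t := by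
    have h : ∀ i, max (q i - p i) 0 = max (p i - q i) 0 + (q i - p i) := fun i => by
      rcases le_total (p i) (q i) with h | h
      · rw [max_eq_left (by linarith), max_eq_right (by linarith)]; ring
      · rw [max_eq_right (by linarith), max_eq_left (by linarith)]; ring
    simp only [h, sum_add_distrib, sum_sub_distrib, hp, hq, hpos]
    ring
  have ht0 : 0 ≤ t := by positivity
  rcases ht0.eq_or_lt with h0 | htp
  · have hz : ∀ i, p i = q i := fun i => by
      have h : ∑ i, |p i - q i| = 0 := by linarith
      have := (sum_eq_zero_iff_of_nonneg fun i _ => abs_nonneg (p i - q i)).1 h i (mem_univ i)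
      linarith [abs_eq_zero.1 this]
    simp [hz, ← h0, fanoFun, Real.zero_rpow (show α ≠ 0 by linarith)]
  -- `e y` is the fraction of `q y` to be moved; it is `0` if `q y = 0`, by the convention for
  -- division. The target `r` vanishes wherever `e` does not, so the matrix has diagonal `1 - e y`.
  set e : ι → ℝ := fun y => max (q y - p y) 0 / q y with he
  set r : ι → ℝ := fun x => max (p x - q x) 0 / t with hr
  have hr0 : ∀ x, 0 ≤ r x := fun x => div_nonneg (le_max_right _ _) htp.le
  have hr1 : ∑ x, r x = 1 := by
    simp only [hr, ← sum_div, hpos, div_self htp.ne']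
  have he0 : ∀ y, 0 ≤ e y := fun y => div_nonneg (le_max_right _ _) (hq0 y)
  have he1 : ∀ y, e y ≤ 1 := fun y =>
    div_le_one_of_le₀ (max_le (by linarith [hp0 y]) (hq0 y)) (hq0 y)
  have hqe : ∀ y, q y * e y = max (q y - p y) 0 := fun y => by
    rcases (hq0 y).eq_or_lt with h | h
    · rw [← h, zero_mul, max_eq_right (by linarith [hp0 y])]
    · simp only [he]
      field_simp
  have hre : ∀ y, e y * r y = 0 := fun y => by
    rcases le_total (p y) (q y) with h | h
    · simp [hr, max_eq_right (sub_nonpos.2 h)]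
    · simp [he, max_eq_right (sub_nonpos.2 h)]
  have key := sum_rpow_sub_le_of_stochastic (p := p) (q := q)
    (M := fun y x => (if x = y then 1 - e y else 0) + e y * r x) hα hd hq0 hq
    (fun y x => add_nonneg (by split_ifs <;> linarith [he1 y]) (mul_nonneg (he0 y) (hr0 x)))
    (fun y => by
      rw [sum_add_distrib, ← mul_sum, hr1, sum_ite_eq' univ y]
      simp)
    (fun x => by
      simp only [mul_add, sum_add_distrib, ← mul_assoc, hqe, ← sum_mul, hneg]
      simp only [mul_ite, mul_zero, sum_ite_eq, mem_univ, if_true, mul_sub, mul_one, hqe]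
      simp only [hr]
      rw [mul_div_cancel₀ _ htp.ne']
      rcases le_total (p x) (q x) with h | h
      · rw [max_eq_left (by linarith), max_eq_right (by linarith)]; ring
      · rw [max_eq_right (by linarith), max_eq_left (by linarith)]; ring)
  simpa [hre, hqe, hneg] using key

/-! ### Extremal sequences for majorization -/

theorem sum_Icc_succ_eq_sum_Ico (f : ℕ → ℝ) (l d : ℕ) :
    ∑ i ∈ Icc (l + 1) d, f i = ∑ i ∈ Ico l d, f (i + 1) := by
  rw [sum_Ico_add' f l d 1]
  congr 1

/-- Partial sums of an antitone sequence are concave. -/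
theorem sum_range_concave {y : ℕ → ℝ} (hy : Antitone y) {a b c : ℕ} (hab : a ≤ b) (hbc : b ≤ c) :
    ((c : ℝ) - b) * ∑ i ∈ range a, y i + ((b : ℝ) - a) * ∑ i ∈ range c, y i ≤
      ((c : ℝ) - a) * ∑ i ∈ range b, y i := by
  have h1 : ((b : ℝ) - a) * y b ≤ ∑ i ∈ Ico a b, y i := by
    have := card_nsmul_le_sum (Ico a b) y (y b) fun i hi => hy (mem_Ico.1 hi).2.le
    rwa [Nat.card_Ico, nsmul_eq_mul, Nat.cast_sub hab] at this
  have h2 : ∑ i ∈ Ico b c, y i ≤ ((c : ℝ) - b) * y b := by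
    have := sum_le_card_nsmul (Ico b c) y (y b) fun i hi => hy (mem_Ico.1 hi).1
    rwa [Nat.card_Ico, nsmul_eq_mul, Nat.cast_sub hbc] at this
  have h3 := sum_range_add_sum_Ico y hab
  have h4 := sum_range_add_sum_Ico y hbc
  have hab' : (0 : ℝ) ≤ (b : ℝ) - a := sub_nonneg.2 (by exact_mod_cast hab)
  have hbc' : (0 : ℝ) ≤ (c : ℝ) - b := sub_nonneg.2 (by exact_mod_cast hbc)
  have h5 := mul_le_mul_of_nonneg_left h1 hbc'
  have h6 := mul_le_mul_of_nonneg_left h2 hab'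
  rw [← h4, ← h3]
  nlinarith

theorem one_div_le_of_antitone {x : ℕ → ℝ} {d : ℕ} (hd : 0 < d) (hx : Antitone x)
    (hs : ∑ i ∈ range d, x i = 1) : 1 / (d : ℝ) ≤ x 0 := by
  have := sum_le_card_nsmul (range d) x (x 0) fun i _ => hx (Nat.zero_le i)
  rw [hs, card_range, nsmul_eq_mul] at this
  rw [div_le_iff₀ (by exact_mod_cast hd)]
  linarith

theorem le_one_div_of_antitone {x : ℕ → ℝ} {d : ℕ} (hd : 0 < d) (hx : Antitone x)
    (hs : ∑ i ∈ range d, x i = 1) : x (d - 1) ≤ 1 / (d : ℝ) := by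
  have := card_nsmul_le_sum (range d) x (x (d - 1)) fun i hi => hx (by
    have := mem_range.1 hi
    omega)
  rw [hs, card_range, nsmul_eq_mul] at this
  rw [le_div_iff₀ (by exact_mod_cast hd)]
  linarith

theorem sum_max_sub_eq_sum_range {x : ℕ → ℝ} {d m : ℕ} {a : ℝ} (hmd : m ≤ d)
    (h1 : ∀ i < m, a ≤ x i) (h2 : ∀ i, m ≤ i → x i ≤ a) :
    ∑ i ∈ range d, max (x i - a) 0 = ∑ i ∈ range m, |a - x i| := by
  rw [← sum_range_add_sum_Ico _ hmd, sum_eq_zero (s := Ico m d), add_zero]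
  · refine sum_congr rfl fun i hi => ?_
    have := h1 i (mem_range.1 hi)
    rw [max_eq_left (by linarith), abs_of_nonpos (by linarith), neg_sub]
  · intro i hi
    exact max_eq_right (sub_nonpos.2 (h2 i (mem_Ico.1 hi).1))

theorem sum_max_sub_eq_sum_Ico {x : ℕ → ℝ} {d l : ℕ} {a : ℝ} (hld : l ≤ d)
    (h1 : ∀ i < l, a ≤ x i) (h2 : ∀ i, l ≤ i → x i ≤ a) :
    ∑ i ∈ range d, max (a - x i) 0 = ∑ i ∈ Ico l d, |a - x i| := by
  rw [← sum_range_add_sum_Ico _ hld, sum_eq_zero (s := range l), zero_add]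
  · refine sum_congr rfl fun i hi => ?_
    have := h2 i (mem_Ico.1 hi).1
    rw [max_eq_left (by linarith), abs_of_nonneg (by linarith)]
  · intro i hi
    exact max_eq_right (sub_nonpos.2 (h1 i (mem_range.1 hi)))

/-- The weight above level `a` is continuous in `a` and decreases to `0` at `x 0`, so it takes the
value `ε`; `m` is the first index with `x m ≤ a`. Indices start at `0` here, so `x i` stands for the
eigenvalue numbered `i + 1`. -/
theorem exists_high_level {x : ℕ → ℝ} {d : ℕ} {ε : ℝ} (hd : 0 < d) (hx : Antitone x)
    (hs : ∑ i ∈ range d, x i = 1) (hε : 0 < ε)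
    (hlt : ε < ∑ i ∈ range d, max (x i - 1 / d) 0) :
    ∃ a m, 1 / (d : ℝ) ≤ a ∧ a ≤ x 0 ∧ 0 < m ∧ m < d ∧ ∑ i ∈ range m, |a - x i| = ε ∧
      x m ≤ a ∧ a < x (m - 1) := by
  have hc : Continuous fun a : ℝ => ∑ i ∈ range d, max (x i - a) 0 := by fun_prop
  have h0 : ∑ i ∈ range d, max (x i - x 0) 0 = 0 :=
    sum_eq_zero fun i _ => max_eq_right (sub_nonpos.2 (hx (Nat.zero_le i)))
  obtain ⟨a, ⟨ha1, ha2⟩, ha⟩ := intermediate_value_Icc' (one_div_le_of_antitone hd hx hs)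
    hc.continuousOn (show ε ∈ Set.Icc _ _ from ⟨by simp only [h0]; exact hε.le, hlt.le⟩)
  simp only at ha
  have hex : ∃ m, x m ≤ a := ⟨d - 1, (le_one_div_of_antitone hd hx hs).trans ha1⟩
  have hne : a ≠ 1 / (d : ℝ) := by
    rintro rfl
    exact hlt.ne' ha
  classical
  have hm := Nat.find_spec hex
  have hmin : ∀ i < Nat.find hex, a < x i := fun i hi => not_le.1 (Nat.find_min hex hi)
  have hm0 : 0 < Nat.find hex := by
    rw [Nat.find_pos]
    intro h
    have : ∑ i ∈ range d, max (x i - a) 0 = 0 :=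
      sum_eq_zero fun i _ => max_eq_right (sub_nonpos.2 ((hx (Nat.zero_le i)).trans h))
    linarith
  have hmd : Nat.find hex ≤ d - 1 :=
    Nat.find_min' hex ((le_one_div_of_antitone hd hx hs).trans ha1)
  refine ⟨a, Nat.find hex, ha1, ha2, hm0, by omega, ?_, hm, hmin _ (by omega)⟩
  rw [← ha]
  exact (sum_max_sub_eq_sum_range (by omega) (fun i hi => (hmin i hi).le)
    fun i hi => (hx hi).trans hm).symm

/-- The same argument for the weight missing below level `a`. The raised terms start at index `l`,
which corresponds to `d - n`. -/
theorem exists_low_level {x : ℕ → ℝ} {d : ℕ} {ε : ℝ} (hd : 0 < d) (hx : Antitone x)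
    (hs : ∑ i ∈ range d, x i = 1) (hε : 0 < ε)
    (hlt : ε < ∑ i ∈ range d, max (1 / d - x i) 0) :
    ∃ a l, x (d - 1) ≤ a ∧ a ≤ 1 / (d : ℝ) ∧ 0 < l ∧ l < d ∧ ∑ i ∈ Ico l d, |a - x i| = ε ∧
      x l < a ∧ a ≤ x (l - 1) := by
  have hc : Continuous fun a : ℝ => ∑ i ∈ range d, max (a - x i) 0 := by fun_prop
  have h0 : ∀ a ≤ x (d - 1), ∑ i ∈ range d, max (a - x i) 0 = 0 := fun a ha =>
    sum_eq_zero fun i hi => max_eq_right (sub_nonpos.2 (ha.trans (hx (by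
      have := mem_range.1 hi
      omega))))
  obtain ⟨a, ⟨ha1, ha2⟩, ha⟩ := intermediate_value_Icc (le_one_div_of_antitone hd hx hs)
    hc.continuousOn (show ε ∈ Set.Icc _ _ from
      ⟨by simp only [h0 _ le_rfl]; exact hε.le, hlt.le⟩)
  simp only at ha
  have hlast : x (d - 1) < a := by
    by_contra h
    linarith [h0 a (not_lt.1 h)]
  have hex : ∃ l, x l < a := ⟨d - 1, hlast⟩
  classical
  have hl := Nat.find_spec hex
  have hmin : ∀ i < Nat.find hex, a ≤ x i := fun i hi => not_lt.1 (Nat.find_min hex hi)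
  have hl0 : 0 < Nat.find hex := by
    rw [Nat.find_pos]
    exact not_lt.2 (ha2.trans (one_div_le_of_antitone hd hx hs))
  have hld : Nat.find hex ≤ d - 1 := Nat.find_min' hex hlast
  refine ⟨a, Nat.find hex, ha1, ha2, hl0, by omega, ?_, hl, hmin _ (by omega)⟩
  rw [← ha]
  exact (sum_max_sub_eq_sum_Ico (by omega) hmin fun i hi => (hx hi).trans hl.le).symm

/-- The sequence `x` with its first `m` terms replaced by `a`, and those from `l` on by `b`. -/
def flatten (x : ℕ → ℝ) (a : ℝ) (m : ℕ) (b : ℝ) (l : ℕ) (i : ℕ) : ℝ :=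
  if i < m then a else if i < l then x i else b

section Flatten

variable {x : ℕ → ℝ} {d m l : ℕ} {a b ε : ℝ}

/-- The partial sums of the flattened sequence are those of `x` minus `ε` between `m` and `l`, and
linear on `[0, m]` and on `[l, d]`. A competitor `y` has concave partial sums that dominate at `0`,
`m`, `l` and `d`, hence also on the two linear pieces. -/
theorem flatten_properties (hd : 0 < d) (hx : Antitone x) (hx0 : ∀ i, 0 ≤ x i)
    (hs : ∑ i ∈ range d, x i = 1) (hlt : ε < ∑ i ∈ range d, max (x i - 1 / d) 0)
    (hm : 0 < m) (hmd : m < d) (ha : ∑ i ∈ range m, |a - x i| = ε) (ha1 : x m ≤ a)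
    (ha2 : a < x (m - 1)) (hl : 0 < l) (hld : l < d) (hb : ∑ i ∈ Ico l d, |b - x i| = ε)
    (hb1 : x l < b) (hb2 : b ≤ x (l - 1)) :
    (∀ i, flatten x a m b l (i + 1) ≤ flatten x a m b l i) ∧
    (∀ i, 0 ≤ flatten x a m b l i) ∧
    ∑ i ∈ range d, flatten x a m b l i = 1 ∧
    ∑ i ∈ range d, max (flatten x a m b l i - x i) 0 = ε ∧
    ∀ y : ℕ → ℝ, Antitone y → ∑ i ∈ range d, y i = 1 →
      (∀ k ≤ d, ∑ i ∈ range k, x i ≤ ∑ i ∈ range k, y i + ε) →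
      ∀ k ≤ d, ∑ i ∈ range k, flatten x a m b l i ≤ ∑ i ∈ range k, y i := by
  have hlow : ∀ i < m, a ≤ x i := fun i hi => ha2.le.trans (hx (by omega))
  have hhigh : ∀ i < l, b ≤ x i := fun i hi => hb2.trans (hx (by omega))
  have hlow' : ∀ i, m ≤ i → x i ≤ a := fun i hi => (hx hi).trans ha1
  have hhigh' : ∀ i, l ≤ i → x i ≤ b := fun i hi => (hx hi).trans hb1.le
  have hda : 1 / (d : ℝ) < a := by
    by_contra h
    have h1 := sum_max_sub_eq_sum_range hmd.le hlow hlow'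
    have h2 : ∑ i ∈ range d, max (x i - 1 / d) 0 ≤ ∑ i ∈ range d, max (x i - a) 0 :=
      sum_le_sum fun i _ => max_le_max (by linarith) le_rfl
    linarith
  have hlt' : ε < ∑ i ∈ range d, max (1 / d - x i) 0 := by
    have h1 : ∀ i, max (1 / d - x i) 0 = max (x i - 1 / d) 0 + (1 / d - x i) := fun i => by
      rcases le_total (x i) (1 / d) with h | h
      · rw [max_eq_left (by linarith), max_eq_right (by linarith)]; ring
      · rw [max_eq_right (by linarith), max_eq_left (by linarith)]; ring
    have hd' : (d : ℝ) ≠ 0 := by exact_mod_cast hd.ne'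
    have h2 : ∑ i ∈ range d, (1 / (d : ℝ) - x i) = 0 := by
      rw [sum_sub_distrib, hs, sum_const, card_range, nsmul_eq_mul, mul_one_div_cancel hd',
        sub_self]
    simp only [h1, sum_add_distrib, h2, add_zero]
    exact hlt
  have hdb : b < 1 / (d : ℝ) := by
    by_contra h
    have h1 := sum_max_sub_eq_sum_Ico hld.le hhigh hhigh'
    have h2 : ∑ i ∈ range d, max (1 / d - x i) 0 ≤ ∑ i ∈ range d, max (b - x i) 0 :=
      sum_le_sum fun i _ => max_le_max (by linarith) le_rfl
    linarith
  -- The levels satisfy `b < 1 / d < a`, so the raised and the lowered terms cannot overlap.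
  have hml : m ≤ l := by
    by_contra h
    have : x (m - 1) ≤ x l := hx (by omega)
    linarith
  have hb0 : 0 ≤ b := (hx0 l).trans hb1.le
  have hXm : ∑ i ∈ range m, x i = m * a + ε := by
    have h : ∀ i ∈ range m, |a - x i| = x i - a := fun i hi => by
      rw [abs_of_nonpos (sub_nonpos.2 (hlow i (mem_range.1 hi))), neg_sub]
    rw [← ha, sum_congr rfl h, sum_sub_distrib, sum_const, card_range, nsmul_eq_mul]
    ring
  have hXl : ∑ i ∈ Ico l d, x i = ((d : ℝ) - l) * b - ε := by
    have h : ∀ i ∈ Ico l d, |b - x i| = b - x i := fun i hi => by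
      rw [abs_of_nonneg (sub_nonneg.2 (hhigh' i (mem_Ico.1 hi).1))]
    rw [← hb, sum_congr rfl h, sum_sub_distrib, sum_const, Nat.card_Ico, nsmul_eq_mul,
      Nat.cast_sub hld.le]
    ring
  have hXl' := sum_range_add_sum_Ico x hld.le
  rw [hs, hXl] at hXl'
  have hP1 : ∀ k ≤ m, ∑ i ∈ range k, flatten x a m b l i = k * a := fun k hk => by
    have h : ∀ i ∈ range k, flatten x a m b l i = a := fun i hi =>
      if_pos ((mem_range.1 hi).trans_le hk)
    rw [sum_congr rfl h, sum_const, card_range, nsmul_eq_mul]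
  have hP2 : ∀ k, m ≤ k → k ≤ l →
      ∑ i ∈ range k, flatten x a m b l i = ∑ i ∈ range k, x i - ε := fun k hk hk' => by
    have h : ∀ i ∈ Ico m k, flatten x a m b l i = x i := fun i hi =>
      (if_neg (not_lt.2 (mem_Ico.1 hi).1)).trans (if_pos ((mem_Ico.1 hi).2.trans_le hk'))
    rw [← sum_range_add_sum_Ico _ hk, hP1 m le_rfl, ← sum_range_add_sum_Ico x hk, hXm,
      sum_congr rfl h]
    ring
  have hP3 : ∀ k, l ≤ k → ∑ i ∈ range k, flatten x a m b l i = 1 - ((d : ℝ) - k) * b :=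
    fun k hk => by
    have h : ∀ i ∈ Ico l k, flatten x a m b l i = b := fun i hi =>
      (if_neg (not_lt.2 (hml.trans (mem_Ico.1 hi).1))).trans (if_neg (not_lt.2 (mem_Ico.1 hi).1))
    rw [← sum_range_add_sum_Ico _ hk, hP2 l hml le_rfl, sum_congr rfl h, sum_const, Nat.card_Ico,
      nsmul_eq_mul, Nat.cast_sub hk]
    linarith
  refine ⟨fun i => ?_, fun i => ?_, ?_, ?_, fun y hy hys hyx k hk => ?_⟩
  · have hi := hx (Nat.le_succ i)
    simp only [flatten]
    split_ifs with h1 h2 h3 h4 h5 h6 <;> first | omega | linarith | skip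
    · exact hlow' _ (by omega)
    · exact hhigh _ (by omega)
  · simp only [flatten]
    split_ifs
    · exact (hx0 m).trans ha1
    · exact hx0 i
    · exact hb0
  · rw [hP3 d hld.le]
    ring
  · rw [← hb, ← sum_max_sub_eq_sum_Ico hld.le hhigh hhigh', ← sum_range_add_sum_Ico _ hld.le,
      ← sum_range_add_sum_Ico (fun i => max (b - x i) 0) hld.le]
    congr 1
    · refine sum_congr rfl fun i hi => ?_
      have hil := mem_range.1 hi
      rw [max_eq_right (sub_nonpos.2 (hhigh i hil)), flatten]
      split_ifs with h
      · exact max_eq_right (sub_nonpos.2 (hlow i h))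
      · simp
    · refine sum_congr rfl fun i hi => ?_
      have hil := mem_Ico.1 hi
      rw [flatten, if_neg (by omega), if_neg (by omega)]
  · rcases le_total k m with h1 | h1
    · rw [hP1 k h1]
      have h2 := sum_range_concave hy (Nat.zero_le k) h1
      have h3 := hyx m hmd.le
      have hm' : (0 : ℝ) < m := by exact_mod_cast hm
      simp only [range_zero, sum_empty, Nat.cast_zero, sub_zero, mul_zero, zero_add] at h2
      have h4 := mul_le_mul_of_nonneg_left (show (m : ℝ) * a ≤ ∑ i ∈ range m, y i by linarith)
        (Nat.cast_nonneg (α := ℝ) k)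
      refine le_of_mul_le_mul_left ?_ hm'
      linarith
    rcases le_total k l with h2 | h2
    · rw [hP2 k h1 h2]
      linarith [hyx k hk]
    · rw [hP3 k h2]
      have h3 := sum_range_concave hy h2 hk
      have h4 := hyx l hld.le
      have hl' : (0 : ℝ) < (d : ℝ) - l := sub_pos.2 (by exact_mod_cast hld)
      have hk' : (0 : ℝ) ≤ (d : ℝ) - k := sub_nonneg.2 (by exact_mod_cast hk)
      rw [hys] at h3
      have h5 := mul_le_mul_of_nonneg_left
        (show 1 - ((d : ℝ) - l) * b ≤ ∑ i ∈ range l, y i by linarith) hk'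
      refine le_of_mul_le_mul_left ?_ hl'
      linarith

end Flatten

/-- The sequence `x` with the weight `ε` moved to its first term from its last ones: the terms
after `c` are set to zero, and `x c` is decreased by `r`. -/
def concentrate (x : ℕ → ℝ) (ε r : ℝ) (c i : ℕ) : ℝ :=
  if i = 0 then x 0 + ε else if i < c then x i else if i = c then x i - r else 0

/-- Past `k = 0`, the partial sums are those of `x` plus `ε` up to `k = c`, and `1` afterwards. Both
are upper bounds for every competitor. -/
theorem concentrate_properties {x : ℕ → ℝ} {d c : ℕ} {ε r : ℝ} (hx0 : ∀ i, 0 ≤ x i)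
    (hs : ∑ i ∈ range d, x i = 1) (hε : 0 ≤ ε) (hc : 0 < c) (hcd : c < d)
    (hr : r = ε - (1 - ∑ i ∈ range (c + 1), x i)) (hr0 : 0 ≤ r)
    (hgt : ε < 1 - ∑ i ∈ range c, x i) :
    (∀ i, 0 ≤ concentrate x ε r c i) ∧
    ∑ i ∈ range d, concentrate x ε r c i = 1 ∧
    ∑ i ∈ range d, max (concentrate x ε r c i - x i) 0 ≤ ε ∧
    ∀ y : ℕ → ℝ, (∀ i, 0 ≤ y i) → ∑ i ∈ range d, y i = 1 →
      (∀ k ≤ d, ∑ i ∈ range k, y i ≤ ∑ i ∈ range k, x i + ε) →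
      ∀ k ≤ d, ∑ i ∈ range k, y i ≤ ∑ i ∈ range k, concentrate x ε r c i := by
  have hXc := sum_range_succ x c
  have hP1 : ∀ k, 0 < k → k ≤ c →
      ∑ i ∈ range k, concentrate x ε r c i = ∑ i ∈ range k, x i + ε := fun k hk hkc => by
    obtain ⟨k, rfl⟩ := Nat.exists_eq_succ_of_ne_zero hk.ne'
    rw [sum_range_succ', sum_range_succ' x]
    have : ∀ i ∈ range k, concentrate x ε r c (i + 1) = x (i + 1) := fun i hi => by
      have := mem_range.1 hi
      rw [concentrate, if_neg (by omega), if_pos (by omega)]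
    rw [sum_congr rfl this, concentrate, if_pos rfl]
    ring
  have hP2 : ∀ k, c + 1 ≤ k → ∑ i ∈ range k, concentrate x ε r c i = 1 := fun k hk => by
    have : ∀ i ∈ Ico (c + 1) k, concentrate x ε r c i = 0 := fun i hi => by
      have := mem_Ico.1 hi
      rw [concentrate, if_neg (by omega), if_neg (by omega), if_neg (by omega)]
    rw [← sum_range_add_sum_Ico _ hk, sum_eq_zero this, sum_range_succ, hP1 c hc le_rfl,
      concentrate, if_neg (by omega), if_neg (by omega), if_pos rfl]
    linarith
  refine ⟨fun i => ?_, hP2 d hcd, ?_, fun y hy0 hys hyx k hk => ?_⟩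
  · rw [concentrate]
    split_ifs with h1 h2 h3
    · linarith [hx0 0]
    · exact hx0 i
    · rw [h3]
      linarith
    · exact le_rfl
  · obtain ⟨e, rfl⟩ := Nat.exists_eq_succ_of_ne_zero (show d ≠ 0 by omega)
    rw [sum_range_succ', sum_eq_zero, concentrate, if_pos rfl]
    · simp [hε]
    · intro i _
      refine max_eq_right ?_
      rw [concentrate, if_neg (by omega)]
      split_ifs with h2 h3
      · simp
      · linarith
      · linarith [hx0 (i + 1)]
  · rcases Nat.eq_zero_or_pos k with rfl | h0
    · simp
    rcases le_or_gt k c with h1 | h1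
    · rw [hP1 k h0 h1]
      exact hyx k hk
    · rw [hP2 k h1, ← hys]
      exact sum_le_sum_of_subset_of_nonneg (range_subset_range.2 hk) fun i _ _ => hy0 i

/-! ### Spectra of the extremal states -/

variable {H : Type*} [NormedAddCommGroup H] [InnerProductSpace ℂ H] [FiniteDimensional ℂ H]

theorem antitone_mu_succ (σ : State H) : Antitone fun i => mu σ (i + 1) :=
  fun _ _ h => mu_antitone σ (by omega) (by omega)

theorem eq_diagOp (σ : State H) {A : H →L[ℂ] H} {q : ℕ → ℝ}
    (h : ∀ i : Fin (Module.finrank ℂ H), A (σ.2.1.isSymmetric.eigenvectorBasis rfl i) =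
      ((q (i.1 + 1) : ℝ) : ℂ) • σ.2.1.isSymmetric.eigenvectorBasis rfl i) : A = diagOp σ q := by
  apply ContinuousLinearMap.coe_injective
  refine (σ.2.1.isSymmetric.eigenvectorBasis rfl).toBasis.ext fun i => ?_
  simpa [diagOp_apply] using h i

theorem mixed_apply (v : H) : mixed H v = ((1 / (Module.finrank ℂ H : ℝ) : ℝ) : ℂ) • v := by
  simp [mixed]

theorem tailSum_eq (σ : State H) (l : ℕ) :
    tailSum σ l = 1 - ∑ i ∈ range (Module.finrank ℂ H - l), mu σ (i + 1) := by
  have := sum_range_add_sum_Ico (fun i => mu σ (i + 1)) (Nat.sub_le (Module.finrank ℂ H) l)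
  rw [sum_mu] at this
  rw [tailSum, sum_Icc_succ_eq_sum_Ico]
  linarith

variable [CompleteSpace H]

theorem sum_mu_le_of_mem_ball {σ ω : State H} {ε : ℝ} (h : ω ∈ ball ε σ) {k : ℕ}
    (hk : k ≤ Module.finrank ℂ H) :
    ∑ i ∈ range k, mu ω (i + 1) ≤ ∑ i ∈ range k, mu σ (i + 1) + ε := by
  have h' : (1 / 2) * traceNorm (ω.1 - σ.1) ≤ ε := h
  linarith [sum_mu_le_sum_mu_add ω σ hk]

theorem sum_mu_le_of_mem_ball' {σ ω : State H} {ε : ℝ} (h : ω ∈ ball ε σ) {k : ℕ}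
    (hk : k ≤ Module.finrank ℂ H) :
    ∑ i ∈ range k, mu σ (i + 1) ≤ ∑ i ∈ range k, mu ω (i + 1) + ε := by
  have h' : (1 / 2) * traceNorm (ω.1 - σ.1) ≤ ε := h
  have h2 := sum_mu_le_sum_mu_add σ ω hk
  rw [← neg_sub, traceNorm, CFC.abs_neg] at h2
  rw [traceNorm] at h'
  linarith

theorem half_traceNorm_sub_mixed (σ : State H) :
    (1 / 2) * traceNorm (σ.1 - mixed H) = ∑ i ∈ range (Module.finrank ℂ H),
      max (mu σ (i + 1) - 1 / (Module.finrank ℂ H : ℝ)) 0 := by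
  have hd : (Module.finrank ℂ H : ℝ) ≠ 0 := by exact_mod_cast (finrank_pos σ).ne'
  have hm : IsSelfAdjoint (mixed H) := by
    rw [mixed, isSelfAdjoint_iff, star_smul, star_one]
    simp
  have h := traceNorm_eq_sum (σ.2.1.isSymmetric.eigenvectorBasis rfl)
    (σ.2.1.isSelfAdjoint.sub hm)
    (δ := fun i => mu σ (i.1 + 1) - 1 / (Module.finrank ℂ H : ℝ)) (fun i => by
      rw [sub_apply, apply_eigenvectorBasis, mixed_apply, ← sub_smul, Complex.ofReal_sub])
  rw [h, Fin.sum_univ_eq_sum_range (fun i => |mu σ (i + 1) - 1 / (Module.finrank ℂ H : ℝ)|),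
    sum_abs_eq_two_mul_sum_max]
  · ring
  · rw [sum_sub_distrib, sum_mu, sum_const, card_range, nsmul_eq_mul, mul_one_div_cancel hd,
      sub_self]

theorem renyi_diagOp (σ : State H) {q : ℕ → ℝ} (hq : ∀ i, 0 ≤ q (i + 1)) (α : ℝ) :
    renyi α (diagOp σ q) =
      1 / (1 - α) * Real.logb 2 (∑ i ∈ range (Module.finrank ℂ H), q (i + 1) ^ α) := by
  rw [renyi, tr_rpow _ (isPositive_diagOp σ fun i _ => hq i) (diagOp_apply σ q),
    Complex.ofReal_re, Fin.sum_univ_eq_sum_range (fun i => q (i + 1) ^ α)]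

theorem renyi_state (σ : State H) (α : ℝ) :
    renyi α σ.1 =
      1 / (1 - α) * Real.logb 2 (∑ i ∈ range (Module.finrank ℂ H), mu σ (i + 1) ^ α) := by
  conv_lhs => rw [eq_diagOp σ (apply_eigenvectorBasis σ)]
  exact renyi_diagOp σ (fun i => mu_nonneg σ _) α

/-- Existence of a level suffices: `Classical.epsilon` then returns some pair with the defining
properties, and only these are used. -/
theorem isHighLevel_highPair {σ : State H} {ε : ℝ} (hε : 0 < ε)
    (h : ε < (1 / 2) * traceNorm (σ.1 - mixed H)) :
    IsHighLevel σ ε (highPair σ ε).1 (highPair σ ε).2 := by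
  rw [half_traceNorm_sub_mixed] at h
  obtain ⟨a, m, h1, h2, h3, h4, h5, h6, h7⟩ :=
    exists_high_level (finrank_pos σ) (antitone_mu_succ σ) (sum_mu σ) hε h
  refine Classical.epsilon_spec (p := fun x : ℝ × ℕ => IsHighLevel σ ε x.1 x.2) ⟨(a, m), ?_⟩
  have hle : mu σ (0 + 1) ≤ 1 := by
    rw [← sum_mu σ]
    exact single_le_sum (f := fun i => mu σ (i + 1)) (fun i _ => mu_nonneg σ _)
      (mem_range.2 (finrank_pos σ))
  refine ⟨⟨le_trans (by positivity) h1, h2.trans hle⟩, mem_Icc.2 ⟨h3, by omega⟩, ?_, h6, ?_⟩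
  · rw [← h5, range_eq_Ico]
    exact sum_Icc_succ_eq_sum_Ico (fun i => |a - mu σ i|) 0 m
  · rwa [Nat.sub_add_cancel h3] at h7

theorem isLowLevel_lowPair {σ : State H} {ε : ℝ} (hε : 0 < ε)
    (h : ε < (1 / 2) * traceNorm (σ.1 - mixed H)) :
    IsLowLevel σ ε (lowPair σ ε).1 (lowPair σ ε).2 := by
  have hd := finrank_pos σ
  have hd1 : (1 : ℝ) ≤ Module.finrank ℂ H := by exact_mod_cast hd
  have hs : ∑ i ∈ range (Module.finrank ℂ H), (mu σ (i + 1) - 1 / (Module.finrank ℂ H : ℝ)) = 0 := by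
    rw [sum_sub_distrib, sum_mu, sum_const, card_range, nsmul_eq_mul, mul_one_div_cancel, sub_self]
    linarith
  have hs' : ∑ i ∈ range (Module.finrank ℂ H),
      (1 / (Module.finrank ℂ H : ℝ) - mu σ (i + 1)) = 0 := by
    rw [← neg_eq_zero, ← sum_neg_distrib]
    simpa only [neg_sub] using hs
  have hsym := sum_abs_eq_two_mul_sum_max hs'
  simp only [abs_sub_comm (1 / (Module.finrank ℂ H : ℝ))] at hsym
  rw [half_traceNorm_sub_mixed] at h
  have hlt : ε < ∑ i ∈ range (Module.finrank ℂ H),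
      max (1 / (Module.finrank ℂ H : ℝ) - mu σ (i + 1)) 0 := by
    linarith [sum_abs_eq_two_mul_sum_max hs]
  obtain ⟨a, l, h1, h2, h3, h4, h5, h6, h7⟩ :=
    exists_low_level hd (antitone_mu_succ σ) (sum_mu σ) hε hlt
  refine Classical.epsilon_spec (p := fun x : ℝ × ℕ => IsLowLevel σ ε x.1 x.2)
    ⟨(a, Module.finrank ℂ H - l), ?_⟩
  have hl : Module.finrank ℂ H - (Module.finrank ℂ H - l) = l := by omega
  refine ⟨⟨(mu_nonneg σ _).trans h1, h2.trans ?_⟩, mem_Icc.2 ⟨by omega, by omega⟩, ?_, ?_, ?_⟩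
  · exact div_le_one_of_le₀ hd1 (by linarith)
  · rw [hl, ← h5]
    exact sum_Icc_succ_eq_sum_Ico (fun i => |a - mu σ i|) l _
  · rwa [hl]
  · rw [hl]
    rwa [Nat.sub_add_cancel h3] at h7

/-- The spectrum of `rhoMax ε σ` is a probability vector within `ε` of that of `σ` in total
variation, and is majorized by the spectrum of every state of the ball. -/
theorem exists_spectrum_rhoMax (σ : State H) {ε : ℝ} (hε : 0 ≤ ε) :
    ∃ q : ℕ → ℝ, rhoMax ε σ = diagOp σ q ∧
      (∀ i, i + 1 < Module.finrank ℂ H → q (i + 1 + 1) ≤ q (i + 1)) ∧ (∀ i, 0 ≤ q (i + 1)) ∧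
      ∑ i ∈ range (Module.finrank ℂ H), q (i + 1) = 1 ∧
      ∑ i ∈ range (Module.finrank ℂ H), max (q (i + 1) - mu σ (i + 1)) 0 ≤ ε ∧
      ∀ ω ∈ ball ε σ, ∀ k ≤ Module.finrank ℂ H,
        ∑ i ∈ range k, q (i + 1) ≤ ∑ i ∈ range k, mu ω (i + 1) := by
  classical
  have hd := finrank_pos σ
  set d := Module.finrank ℂ H with hdd
  rcases hε.eq_or_lt with rfl | hε
  · refine ⟨mu σ, ?_, fun i _ => mu_antitone σ (by omega) (by omega), fun i => mu_nonneg σ _,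
      sum_mu σ, by simp, fun ω hω k hk => ?_⟩
    · rw [rhoMax, if_pos rfl]
      exact eq_diagOp σ (apply_eigenvectorBasis σ)
    · simpa using sum_mu_le_of_mem_ball' hω hk
  by_cases hmix : (1 / 2) * traceNorm (σ.1 - mixed H) ≤ ε
  · have hd0 : (d : ℝ) ≠ 0 := by exact_mod_cast hd.ne'
    have hsum : ∑ i ∈ range d, (1 / (d : ℝ)) = 1 := by
      rw [sum_const, card_range, nsmul_eq_mul, mul_one_div_cancel hd0]
    refine ⟨fun _ => 1 / d, ?_, fun i _ => le_rfl, fun i => by positivity, hsum, ?_,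
      fun ω hω k hk => ?_⟩
    · rw [rhoMax, if_neg hε.ne', if_pos hmix]
      exact eq_diagOp σ fun i => mixed_apply _
    · rw [half_traceNorm_sub_mixed] at hmix
      have hs : ∑ i ∈ range d, (mu σ (i + 1) - 1 / (d : ℝ)) = 0 := by
        rw [sum_sub_distrib, sum_mu, hsum, sub_self]
      have hs' : ∑ i ∈ range d, (1 / (d : ℝ) - mu σ (i + 1)) = 0 := by
        rw [sum_sub_distrib, sum_mu, hsum, sub_self]
      have h1 := sum_abs_eq_two_mul_sum_max hs
      have h2 := sum_abs_eq_two_mul_sum_max hs'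
      simp only [abs_sub_comm (1 / (d : ℝ))] at h2
      linarith
    -- Concave partial sums from `0` to `1` lie above the chord `k / d`.
    · have h := sum_range_concave (antitone_mu_succ ω) (Nat.zero_le k) hk
      rw [sum_mu] at h
      simp only [range_zero, sum_empty, Nat.cast_zero, sub_zero, mul_zero, zero_add, mul_one] at h
      rw [sum_const, card_range, nsmul_eq_mul, mul_one_div, div_le_iff₀ (by positivity)]
      linarith
  · have hlt := not_le.1 hmix
    obtain ⟨-, hm, hms, hm1, hm2⟩ := isHighLevel_highPair hε hlt
    obtain ⟨-, hn, hns, hn1, hn2⟩ := isLowLevel_lowPair hε hlt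
    rw [mem_Icc] at hm hn
    set a := (highPair σ ε).1
    set m := (highPair σ ε).2
    set b := (lowPair σ ε).1
    set n := (lowPair σ ε).2
    rw [half_traceNorm_sub_mixed] at hlt
    have hms' : ∑ i ∈ range m, |a - mu σ (i + 1)| = ε := by
      rw [← hms, range_eq_Ico]
      exact (sum_Icc_succ_eq_sum_Ico (fun i => |a - mu σ i|) 0 m).symm
    have hns' : ∑ i ∈ Ico (d - n) d, |b - mu σ (i + 1)| = ε := by
      rw [← hns]
      exact (sum_Icc_succ_eq_sum_Ico (fun i => |b - mu σ i|) (d - n) d).symm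
    obtain ⟨h1, h2, h3, h4, h5⟩ := flatten_properties (x := fun i => mu σ (i + 1)) (d := d)
      (m := m) (l := d - n) (a := a) (b := b) hd (antitone_mu_succ σ) (fun i => mu_nonneg σ _)
      (sum_mu σ) hlt (by omega) (by omega) hms' hm1
      (by rwa [Nat.sub_add_cancel hm.1]) (by omega) (by omega) hns' hn1
      (by rwa [Nat.sub_add_cancel (by omega)])
    -- The passage to indices from `0` is definitional: `i < m` unfolds to `i + 1 ≤ m`.
    have hq : ∀ i, (if i + 1 ≤ m then a else if i + 1 ≤ d - n then mu σ (i + 1) else b) =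
        flatten (fun i => mu σ (i + 1)) a m b (d - n) i := fun i => rfl
    refine ⟨fun j => if j ≤ m then a else if j ≤ d - n then mu σ j else b, ?_, ?_⟩
    · rw [rhoMax, if_neg hε.ne', if_neg hmix]
    · simp only [hq]
      exact ⟨fun i _ => h1 i, h2, h3, h4.le, fun ω hω => h5 _ (antitone_mu_succ ω) (sum_mu ω)
        fun k hk => sum_mu_le_of_mem_ball' hω hk⟩

/-- The spectrum of `rhoMin ε σ` is a probability vector within `ε` of that of `σ` in total
variation, and majorizes the spectrum of every state of the ball. -/
theorem exists_spectrum_rhoMin (σ : State H) {ε : ℝ} (hε : 0 ≤ ε) :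
    ∃ q : ℕ → ℝ, rhoMin ε σ = diagOp σ q ∧ (∀ i, 0 ≤ q (i + 1)) ∧
      ∑ i ∈ range (Module.finrank ℂ H), q (i + 1) = 1 ∧
      ∑ i ∈ range (Module.finrank ℂ H), max (q (i + 1) - mu σ (i + 1)) 0 ≤ ε ∧
      ∀ ω ∈ ball ε σ, ∀ k ≤ Module.finrank ℂ H,
        ∑ i ∈ range k, mu ω (i + 1) ≤ ∑ i ∈ range k, q (i + 1) := by
  classical
  have hd := finrank_pos σ
  set d := Module.finrank ℂ H with hdd
  have hle : cutIndex ε σ ≤ d - 1 := Nat.findGreatest_le _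
  have hspec : tailSum σ (cutIndex ε σ) ≤ ε :=
    Nat.findGreatest_spec (P := fun l => tailSum σ l ≤ ε) (Nat.zero_le (d - 1)) (by
      simpa [tailSum] using hε)
  rcases hle.eq_or_lt with heq | hlt
  · have hsum : ∀ k, 0 < k → ∑ i ∈ range k, (if i + 1 = 1 then (1 : ℝ) else 0) = 1 :=
      fun k hk => by simp [hk]
    refine ⟨fun j => if j = 1 then 1 else 0, ?_,
      fun i => by dsimp only; split_ifs <;> norm_num, hsum d hd, ?_,
      fun ω hω k hk => ?_⟩
    · rw [rhoMin]
      simp only [← hdd, heq, if_true]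
    · rw [heq, tailSum_eq σ, ← hdd, show d - (d - 1) = 1 by omega] at hspec
      obtain ⟨e, he⟩ := Nat.exists_eq_succ_of_ne_zero hd.ne'
      rw [he, sum_range_succ', sum_eq_zero]
      · simp only [sum_range_one] at hspec
        simp only [zero_add, if_true]
        exact max_le (by linarith) hε
      · intro i _
        refine max_eq_right ?_
        dsimp only
        rw [if_neg (by omega)]
        linarith [mu_nonneg σ (i + 1 + 1)]
    · rcases Nat.eq_zero_or_pos k with rfl | hk0
      · simp
      · simp only
        rw [hsum k hk0, ← sum_mu ω]
        exact sum_le_sum_of_subset_of_nonneg (range_subset_range.2 hk) fun i _ _ => mu_nonneg ω _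
  · have hgt : ε < tailSum σ (cutIndex ε σ + 1) :=
      not_le.1 (Nat.findGreatest_is_greatest (P := fun l => tailSum σ l ≤ ε) (Nat.lt_succ_self _)
        (by omega : cutIndex ε σ + 1 ≤ d - 1))
    -- `c` is the index, counted from `0`, of the partially decreased eigenvalue. Maximality of the
    -- cut keeps it positive after the decrease.
    obtain ⟨c, hc⟩ : ∃ c, c + 1 = d - cutIndex ε σ := ⟨d - cutIndex ε σ - 1, by omega⟩
    have hT := tailSum_eq σ (cutIndex ε σ)
    have hT' := tailSum_eq σ (cutIndex ε σ + 1)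
    rw [← hdd, ← hc] at hT
    rw [← hdd, show d - (cutIndex ε σ + 1) = c by omega] at hT'
    obtain ⟨h2, h3, h4, h5⟩ := concentrate_properties (x := fun i => mu σ (i + 1)) (d := d)
      (c := c) (r := ε - tailSum σ (cutIndex ε σ)) (fun i => mu_nonneg σ _)
      (sum_mu σ) hε (by omega) (by omega) (by rw [hT]) (sub_nonneg.2 hspec) (hT' ▸ hgt)
    set q : ℕ → ℝ := fun j =>
      if cutIndex ε σ = d - 1 then (if j = 1 then 1 else 0)
      else if j = 1 then mu σ 1 + ε
      else if j < d - cutIndex ε σ then mu σ j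
      else if j = d - cutIndex ε σ then mu σ j - (ε - tailSum σ (cutIndex ε σ))
      else 0 with hqdef
    have hq : ∀ i, q (i + 1) = concentrate (fun i => mu σ (i + 1)) ε
        (ε - tailSum σ (cutIndex ε σ)) c i := fun i => by
      simp only [hqdef, if_neg hlt.ne, ← hc, concentrate, Nat.add_lt_add_iff_right,
        Nat.add_right_cancel_iff, Nat.add_eq_right, zero_add]
    refine ⟨q, rfl, ?_⟩
    simp only [hq]
    exact ⟨h2, h3, h4, fun ω hω => h5 _ (fun i => mu_nonneg ω _) (sum_mu ω)
      fun k hk => sum_mu_le_of_mem_ball hω hk⟩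

/-! ### From power sums to entropies -/

theorem sum_rpow_pos {ι : Type*} {s : Finset ι} {p : ι → ℝ} (hp0 : ∀ i ∈ s, 0 ≤ p i)
    (hp : ∑ i ∈ s, p i = 1) (α : ℝ) : 0 < ∑ i ∈ s, p i ^ α := by
  obtain ⟨i, hi, hne⟩ := exists_ne_zero_of_sum_ne_zero (hp ▸ one_ne_zero : ∑ i ∈ s, p i ≠ 0)
  exact sum_pos' (fun j hj => Real.rpow_nonneg (hp0 j hj) α)
    ⟨i, hi, Real.rpow_pos_of_pos ((hp0 i hi).lt_of_ne' hne) α⟩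

theorem one_le_sum_rpow {ι : Type*} {s : Finset ι} {p : ι → ℝ} (hp0 : ∀ i ∈ s, 0 ≤ p i)
    (hp : ∑ i ∈ s, p i = 1) {α : ℝ} (h0 : 0 ≤ α) (h1 : α ≤ 1) : 1 ≤ ∑ i ∈ s, p i ^ α := by
  rw [← hp]
  refine sum_le_sum fun i hi => ?_
  simpa using Real.rpow_le_rpow_of_exponent_ge' (hp0 i hi) (hp ▸ single_le_sum hp0 hi) h0 h1

theorem sum_rpow_le_one {ι : Type*} {s : Finset ι} {p : ι → ℝ} (hp0 : ∀ i ∈ s, 0 ≤ p i)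
    (hp : ∑ i ∈ s, p i = 1) {α : ℝ} (h1 : 1 ≤ α) : ∑ i ∈ s, p i ^ α ≤ 1 := by
  simpa [hp] using sum_rpow_le_rpow_sum s h1 hp0

theorem one_le_card_rpow_mul_sum_rpow {ι : Type*} {s : Finset ι} {p : ι → ℝ}
    (hp0 : ∀ i ∈ s, 0 ≤ p i) (hp : ∑ i ∈ s, p i = 1) {α : ℝ} (h1 : 1 ≤ α) :
    1 ≤ (#s : ℝ) ^ (α - 1) * ∑ i ∈ s, p i ^ α := by
  simpa [hp] using Real.rpow_sum_le_const_mul_sum_rpow_of_nonneg s h1 hp0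

theorem log_sub_log_le {a b : ℝ} (ha : 0 < a) (hb : 0 < b) :
    Real.log a - Real.log b ≤ (a - b) / b := by
  rw [← Real.log_div ha.ne' hb.ne', sub_div, div_self hb.ne']
  exact Real.log_le_sub_one_of_pos (div_pos ha hb)

/-- Passing to natural logarithms leaves the sign of `cConst α` as the only trace of the case
distinction in `α`. -/
theorem one_div_mul_logb_sub (α a b : ℝ) :
    1 / (1 - α) * Real.logb 2 a - 1 / (1 - α) * Real.logb 2 b =
      cConst α * (Real.log a - Real.log b) := by
  simp only [Real.logb, cConst, mul_inv]
  ring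

theorem cConst_pos {α : ℝ} (h : α < 1) : 0 < cConst α :=
  inv_pos.2 (mul_pos (Real.log_pos one_lt_two) (by linarith))

theorem cConst_neg {α : ℝ} (h : 1 < α) : cConst α < 0 :=
  inv_lt_zero.2 (mul_neg_of_pos_of_neg (Real.log_pos one_lt_two) (by linarith))

/-- The Rényi entropy is Schur concave. -/
theorem logb_sum_rpow_le_of_majorized {d : ℕ} {p q : ℕ → ℝ} {α : ℝ}
    (hα : α ∈ Set.Ioo (0 : ℝ) 1 ∪ Set.Ioi 1)
    (hp : ∀ i, i + 1 < d → p (i + 1) ≤ p i) (hp0 : ∀ i, 0 ≤ p i) (hq0 : ∀ i, 0 ≤ q i)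
    (hp1 : ∑ i ∈ range d, p i = 1) (hq1 : ∑ i ∈ range d, q i = 1)
    (hle : ∀ k ≤ d, ∑ i ∈ range k, p i ≤ ∑ i ∈ range k, q i) :
    1 / (1 - α) * Real.logb 2 (∑ i ∈ range d, q i ^ α) ≤
      1 / (1 - α) * Real.logb 2 (∑ i ∈ range d, p i ^ α) := by
  have hP := sum_rpow_pos (fun i _ => hp0 i) hp1 α
  have hQ := sum_rpow_pos (fun i _ => hq0 i) hq1 α
  rw [← sub_nonneg, one_div_mul_logb_sub]
  rcases hα with ⟨h0, h1⟩ | h1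
  · have := sum_rpow_ge_of_majorized h0 h1 hp (fun i _ => hp0 i) (fun i _ => hq0 i) hle
      (hp1.trans hq1.symm)
    exact mul_nonneg (cConst_pos h1).le (sub_nonneg.2 (Real.log_le_log hQ this))
  · have := sum_rpow_le_of_majorized h1 hp (fun i _ => hp0 i) (fun i _ => hq0 i) hle
      (hp1.trans hq1.symm)
    exact mul_nonneg_of_nonpos_of_nonpos (cConst_neg h1).le
      (sub_nonpos.2 (Real.log_le_log hP this))

section Bounds

variable {ι : Type*} [Fintype ι] {α ε : ℝ} {p q : ι → ℝ}

theorem entropy_sub_le_of_lt_one (h0 : 0 < α) (h1 : α < 1)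
    (hε0 : 0 ≤ ε) (hε : ε < α ^ (1 / (1 - α))) (hp0 : ∀ i, 0 ≤ p i)
    (hq0 : ∀ i, 0 ≤ q i) (hp : ∑ i, p i = 1) (hq : ∑ i, q i = 1)
    (hpq : (1 / 2) * ∑ i, |p i - q i| ≤ ε) :
    1 / (1 - α) * Real.logb 2 (∑ i, p i ^ α) - 1 / (1 - α) * Real.logb 2 (∑ i, q i ^ α) ≤
      (2 * ε) ^ α * gFun α (Fintype.card ι) + etaFun α (2 * ε) := by
  have hA := sum_rpow_pos (fun i _ => hp0 i) hp α
  have hB := one_le_sum_rpow (fun i _ => hq0 i) hq h0.le h1.le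
  have hG := sum_rpow_sub_le_of_lt_one h0 h1 hε0 hε hp0 hq0 hp hq hpq
  -- Comparing `p` with itself shows that the bound is nonnegative, so dividing by `∑ q ^ α ≥ 1`
  -- does no harm.
  have hG0 := sum_rpow_sub_le_of_lt_one h0 h1 hε0 hε hp0 hp0 hp hp (by simpa using hε0)
  rw [sub_self] at hG0
  have hlog : Real.log (∑ i, p i ^ α) - Real.log (∑ i, q i ^ α) ≤
      (Fintype.card ι : ℝ) ^ (1 - α) * (2 * ε) ^ α - 2 * ε := by
    refine (log_sub_log_le hA (by linarith)).trans ?_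
    rw [div_le_iff₀ (by linarith)]
    nlinarith
  rw [one_div_mul_logb_sub]
  calc _ ≤ _ := mul_le_mul_of_nonneg_left hlog (cConst_pos h1).le
    _ = _ := by simp only [gFun, etaFun]; ring

theorem entropy_sub_le_of_one_lt (h1 : 1 < α)
    (hε0 : 0 ≤ ε) (hε : ε < 1 - 1 / (Fintype.card ι : ℝ)) (hp0 : ∀ i, 0 ≤ p i)
    (hq0 : ∀ i, 0 ≤ q i) (hp : ∑ i, p i = 1) (hq : ∑ i, q i = 1)
    (hpq : (1 / 2) * ∑ i, |p i - q i| ≤ ε) :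
    1 / (1 - α) * Real.logb 2 (∑ i, p i ^ α) - 1 / (1 - α) * Real.logb 2 (∑ i, q i ^ α) ≤
      (Fintype.card ι : ℝ) ^ (2 * (α - 1)) *
        (gFun α ((Fintype.card ι : ℝ) - 1) + rFun α ε) := by
  have hd : 2 ≤ Fintype.card ι := by
    by_contra h
    have h' : Fintype.card ι = 0 ∨ Fintype.card ι = 1 := by omega
    rcases h' with h' | h'
    · rw [Fintype.card_eq_zero_iff] at h'
      simp at hp
    · rw [h'] at hε
      norm_num at hε
      linarith
  have hd' : (2 : ℝ) ≤ Fintype.card ι := by exact_mod_cast hd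
  have hA := sum_rpow_pos (fun i _ => hp0 i) hp α
  have hB := sum_rpow_pos (fun i _ => hq0 i) hq α
  have hdA := one_le_card_rpow_mul_sum_rpow (fun i _ => hp0 i) hp h1.le
  have hF := (sum_rpow_sub_le_fanoFun h1 hd hp0 hq0 hp hq).trans
    (fanoFun_mono h1 (by linarith) (by positivity) hpq hε.le)
  rw [card_univ] at hdA
  set d : ℝ := (Fintype.card ι : ℝ) with hdd
  have hx : ε ^ α ≤ 1 :=
    Real.rpow_le_one hε0 (by have : 0 ≤ 1 / d := by positivity
                             linarith) (by linarith)
  have hy : (d - 1) ^ (1 - α) ≤ 1 :=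
    Real.rpow_le_one_of_one_le_of_nonpos (by linarith) (by linarith)
  -- Chosen so that `-cConst α * F` is the bracket of the claim. The excess of `F` over `fanoFun α d
  -- ε` is `(1 - ε ^ α) * (1 - (d - 1) ^ (1 - α))`.
  set F := 2 - (d - 1) ^ (1 - α) - ε ^ α - (1 - ε) ^ α with hFdef
  have hFF : fanoFun α d ε ≤ F := by
    rw [fanoFun, hFdef]
    nlinarith [mul_nonneg (sub_nonneg.2 hx) (sub_nonneg.2 hy)]
  have hF0 : 0 ≤ F := by
    refine le_trans ?_ hFF
    have := fanoFun_mono h1 (show 1 < d by linarith) le_rfl hε0 hε.le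
    simpa [fanoFun, Real.zero_rpow (show α ≠ 0 by linarith)] using this
  have hlog : Real.log (∑ i, q i ^ α) - Real.log (∑ i, p i ^ α) ≤ d ^ (2 * (α - 1)) * F := by
    refine (log_sub_log_le hB hA).trans ?_
    -- Division by `∑ p ^ α` costs only `d ^ (α - 1)`; the claimed factor is larger.
    have hdd : d ^ (α - 1) ≤ d ^ (2 * (α - 1)) :=
      Real.rpow_le_rpow_of_exponent_le (by linarith) (by linarith)
    calc _ ≤ F / ∑ i, p i ^ α := div_le_div_of_nonneg_right (hF.trans hFF) hA.le
      _ ≤ d ^ (α - 1) * F := by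
          rw [div_le_iff₀ hA]
          nlinarith
      _ ≤ _ := mul_le_mul_of_nonneg_right hdd hF0
  rw [one_div_mul_logb_sub]
  have := mul_le_mul_of_nonneg_left hlog (neg_nonneg.2 (cConst_neg h1).le)
  calc _ = -cConst α * (Real.log (∑ i, q i ^ α) - Real.log (∑ i, p i ^ α)) := by ring
    _ ≤ _ := this
    _ = _ := by simp only [gFun, rFun, hFdef]; ring

/-- Entropies lie between `0` and `log d`: power sums are at most `1`, and at least `d ^ (1 - α)` by
the power mean inequality. -/
theorem entropy_sub_le_logb (h1 : 1 < α) (hp0 : ∀ i, 0 ≤ p i)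
    (hq0 : ∀ i, 0 ≤ q i) (hp : ∑ i, p i = 1) (hq : ∑ i, q i = 1) :
    1 / (1 - α) * Real.logb 2 (∑ i, p i ^ α) - 1 / (1 - α) * Real.logb 2 (∑ i, q i ^ α) ≤
      Real.logb 2 (Fintype.card ι) := by
  have hd : (0 : ℝ) < Fintype.card ι := by
    rw [Nat.cast_pos, Fintype.card_pos_iff]
    by_contra hne
    rw [not_nonempty_iff] at hne
    simp at hp
  have hA := sum_rpow_pos (fun i _ => hp0 i) hp α
  have hB := sum_rpow_pos (fun i _ => hq0 i) hq α
  have hdA := one_le_card_rpow_mul_sum_rpow (fun i _ => hp0 i) hp h1.le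
  have hB1 := Real.log_nonpos hB.le (sum_rpow_le_one (fun i _ => hq0 i) hq h1.le)
  have hA1 := Real.log_nonneg hdA
  rw [card_univ, Real.log_mul (by positivity) hA.ne', Real.log_rpow hd] at hA1
  rw [one_div_mul_logb_sub]
  have hc := mul_le_mul_of_nonpos_left
    (show (1 - α) * Real.log (Fintype.card ι) ≤
      Real.log (∑ i, p i ^ α) - Real.log (∑ i, q i ^ α) by linarith) (cConst_neg h1).le
  refine hc.trans (le_of_eq ?_)
  have h2 : (1 - α) ≠ 0 := by linarith
  have h3 := (Real.log_pos one_lt_two).ne'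
  rw [cConst, Real.logb]
  field_simp

end Bounds

/-! ### The local bound and its estimates -/

theorem half_sum_abs_le {d : ℕ} {p q : ℕ → ℝ} {ε : ℝ} (hp1 : ∑ i ∈ range d, p i = 1)
    (hq1 : ∑ i ∈ range d, q i = 1) (h : ∑ i ∈ range d, max (p i - q i) 0 ≤ ε) :
    (1 / 2) * ∑ i : Fin d, |p i - q i| ≤ ε := by
  rw [Fin.sum_univ_eq_sum_range (fun i => |p i - q i|), sum_abs_eq_two_mul_sum_max]
  · linarith
  · rw [sum_sub_distrib, hp1, hq1, sub_self]

theorem abs_renyi_sub_le_localBound {α : ℝ} (hα : α ∈ Set.Ioo (0 : ℝ) 1 ∪ Set.Ioi 1)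
    {σ ω : State H} {ε : ℝ} (hε : 0 ≤ ε) (hω : ω ∈ ball ε σ) :
    |renyi α ω.1 - renyi α σ.1| ≤ localBound α ε σ := by
  obtain ⟨q, hq, hq1, hq2, hq3, -, hq4⟩ := exists_spectrum_rhoMax σ hε
  obtain ⟨r, hr, hr2, hr3, -, hr4⟩ := exists_spectrum_rhoMin σ hε
  have h1 : renyi α ω.1 ≤ renyi α (rhoMax ε σ) := by
    rw [hq, renyi_diagOp σ hq2, renyi_state]
    exact logb_sum_rpow_le_of_majorized (p := fun i => q (i + 1)) (q := fun i => mu ω (i + 1)) hα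
      hq1 hq2 (fun i => mu_nonneg ω _) hq3 (sum_mu ω) (hq4 ω hω)
  have h2 : renyi α (rhoMin ε σ) ≤ renyi α ω.1 := by
    rw [hr, renyi_diagOp σ hr2, renyi_state]
    exact logb_sum_rpow_le_of_majorized (p := fun i => mu ω (i + 1)) (q := fun i => r (i + 1)) hα
      (fun i _ => antitone_mu_succ ω (Nat.le_succ i)) (fun i => mu_nonneg ω _) hr2 (sum_mu ω) hr3
      (hr4 ω hω)
  rw [localBound, abs_le']
  exact ⟨le_max_of_le_left (by linarith), le_max_of_le_right (by linarith)⟩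

/-- An upper bound on the entropy difference of probability vectors at total variation distance at
most `ε` bounds `localBound`. -/
theorem localBound_le {α ε B : ℝ} (σ : State H) (hε : 0 ≤ ε)
    (h : ∀ p q : Fin (Module.finrank ℂ H) → ℝ, (∀ i, 0 ≤ p i) → (∀ i, 0 ≤ q i) →
      ∑ i, p i = 1 → ∑ i, q i = 1 → (1 / 2) * ∑ i, |p i - q i| ≤ ε →
      1 / (1 - α) * Real.logb 2 (∑ i, p i ^ α) - 1 / (1 - α) * Real.logb 2 (∑ i, q i ^ α) ≤ B) :
    localBound α ε σ ≤ B := by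
  obtain ⟨q, hq, -, hq2, hq3, hq4, -⟩ := exists_spectrum_rhoMax σ hε
  obtain ⟨r, hr, hr2, hr3, hr4, -⟩ := exists_spectrum_rhoMin σ hε
  have hsum : ∀ f : ℕ → ℝ, ∑ i : Fin (Module.finrank ℂ H), f i =
      ∑ i ∈ range (Module.finrank ℂ H), f i := fun f => Fin.sum_univ_eq_sum_range f _
  have hμ := fun i => mu_nonneg σ (i + 1)
  have h1 := half_sum_abs_le (p := fun i => q (i + 1)) (q := fun i => mu σ (i + 1)) hq3
    (sum_mu σ) hq4
  have h2 := half_sum_abs_le (p := fun i => r (i + 1)) (q := fun i => mu σ (i + 1)) hr3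
    (sum_mu σ) hr4
  simp only [abs_sub_comm (r _)] at h2
  rw [localBound, hq, hr, renyi_diagOp σ hq2, renyi_diagOp σ hr2, renyi_state]
  simp only [← hsum (fun i => q (i + 1)), ← hsum (fun i => r (i + 1)),
    ← hsum (fun i => q (i + 1) ^ α), ← hsum (fun i => r (i + 1) ^ α),
    ← hsum (fun i => mu σ (i + 1) ^ α)] at hq3 hr3 ⊢
  have hμ1 := sum_mu σ
  rw [← hsum (fun i => mu σ (i + 1))] at hμ1
  exact max_le (h _ _ (fun i => hq2 i) (fun i => hμ i) hq3 hμ1 h1)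
    (h _ _ (fun i => hμ i) (fun i => hr2 i) hμ1 hr3 h2)

end RenyiBall

theorem proposition3p4 {H : Type*} [NormedAddCommGroup H] [InnerProductSpace ℂ H]
    [FiniteDimensional ℂ H] [CompleteSpace H] (d : ℕ) (hd : Module.finrank ℂ H = d)
    (α : ℝ) (hα : α ∈ Set.Ioo (0 : ℝ) 1 ∪ Set.Ioi 1) (σ : RenyiBall.State H)
    (ε : ℝ) (hε : ε ∈ Set.Icc (0 : ℝ) 1) :
    (∀ ω ∈ RenyiBall.ball ε σ,
      |RenyiBall.renyi α ω.1 - RenyiBall.renyi α σ.1| ≤ RenyiBall.localBound α ε σ) ∧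
    (α < 1 → ε < α ^ (1 / (1 - α)) →
      RenyiBall.localBound α ε σ ≤
        (2 * ε) ^ α * RenyiBall.gFun α d + RenyiBall.etaFun α (2 * ε)) ∧
    (1 < α → ε < 1 - 1 / (d : ℝ) →
      RenyiBall.localBound α ε σ ≤
        (d : ℝ) ^ (2 * (α - 1)) * (RenyiBall.gFun α ((d : ℝ) - 1) + RenyiBall.rFun α ε)) ∧
    (1 < α → 1 - 1 / (d : ℝ) ≤ ε →
      RenyiBall.localBound α ε σ ≤ Real.logb 2 d) := by
  subst hd
  refine ⟨fun ω hω => RenyiBall.abs_renyi_sub_le_localBound hα hε.1 hω, fun h1 h2 => ?_,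
    fun h1 h2 => ?_, fun h1 _ => ?_⟩
  · have h0 : 0 < α := hα.elim (fun h => h.1) fun h => zero_lt_one.trans h
    refine RenyiBall.localBound_le σ hε.1 fun p q hp0 hq0 hp hq hpq => ?_
    simpa using RenyiBall.entropy_sub_le_of_lt_one h0 h1 hε.1 h2 hp0 hq0 hp hq hpq
  · refine RenyiBall.localBound_le σ hε.1 fun p q hp0 hq0 hp hq hpq => ?_
    simpa using RenyiBall.entropy_sub_le_of_one_lt h1 hε.1 (by simpa using h2) hp0 hq0 hp hq hpq
  · refine RenyiBall.localBound_le σ hε.1 fun p q hp0 hq0 hp hq _ => ?_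
    simpa using RenyiBall.entropy_sub_le_logb h1 hp0 hq0 hp hq
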